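/- **Generalized Global Cauchy Integral Theorem.** Identify $\mathbb{C}$ with $\mathbb{R}^2$ and let $\hat{\mathcal B}_k^r$ be the Banach space of differential $k$-chains of order $r$ on $\mathbb{R}^2$, that is, the completion of the space $\mathcal P_k$ of pointed $k$-chains (finite formal sums $\sum (p_i;\alpha_i)$ with $p_i\in\mathbb{R}^2$, $\alpha_i\in\Lambda^k\mathbb{R}^2$) in the norm $$\|A\|_{B^r}=\inf\Big\{\sum_i \|u_{i,1}\|\cdots\|u_{i,j_i}\|\,\|\alpha_i\| \;:\; A=\sum_i \Delta_{u_{i,1}}\cdots\Delta_{u_{i,j_i}}(p_i;\alpha_i),\ 0\le j_i\le r\Big\},\qquad \Delta_u(p;\alpha)=(p+u;\alpha)-(p;\alpha).$$ Chains of order $r$ are regarded as chains of order $s\ge r$ through the continuous extension of the identity of $\mathcal P_k$. The boundary is $\partial=P_{e_1}E_{e_1}^\dagger+P_{e_2}E_{e_2}^\dagger$, where $P_v(p;\alpha)=\lim_{t\to0}\frac1t\Delta_{tv}(p;\alpha)$ and $E_v^\dagger$ is contraction with $v$; it maps $\hat{\mathcal B}_k^r$ continuously to $\hat{\mathcal B}_{k-1}^{s}$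 for $s\ge\max(r+1,2)$. A closed set $X$ supports a chain $J$ of order $r$ if for every non-empty open $W\supseteq X$ the chain $J$ is a limit in $\hat{\mathcal B}_k^r$ of pointed chains in $W$; $\operatorname{supp}(J)$ is the intersection of all closed sets supporting $J$. The mass of a chain $K$ is the infimum of $\liminf_i\|A_i\|_{B^0}$ over all sequences of pointed chains $A_i\to K$. A form belongs to $\mathcal B^r$ if $|\omega(A)|\le C\|A\|_{B^r}$ for all pointed chains $A$ and some constant $C$, and its integral over chains of order $r$ is the continuous extension of $\sum(p_i;\alpha_i)\mapsto\sum\omega_{p_i}(\alpha_i)$. For a form $\omega$ defined near $\operatorname{supp}(J)$, $\int_J\omega$ is the integral over $J$ of any form in $\mathcal B^r$ that agrees with $\omega$ in a neighbourhood of $\operatorname{supp}(J)$; $\omega$ is called integrable over $J$ if there is such a form. For $z\notin\operatorname{supp}(J)$ put $\operatorname{Ind}_J(z)=\frac1{2\pi i}\int_J\frac{dw}{w-z}$. Let $r\ge1$, let $J\in\hat{\mathcal B}_1^r$ be closed ($\partial J=0$), and let $U\subset\mathbb{C}$ be a bounded open set (not necessarily contractible) with $\operatorname{supp}(J)\subseteq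 U$ and $\operatorname{Ind}_J(w)=0$ for all $w\in\mathbb{C}\setminus U$. Suppose that there is a chain $K\in\hat{\mathcal B}_2^{r-1}$ of finite mass with $\partial K=J$. Then for every holomorphic $f:U\to\mathbb{C}$ the form $f(z)\,dz$ is integrable over $J$ and $$\int_J f(z)\,dz=0 .$$ -/

import Mathlib

open Filter Topology

set_option linter.unusedSectionVars false

noncomputable section

/-! # Differential chains

`E` is the ambient Euclidean space and `V` is the normed space of `k`-vectors of `E`, with the
mass norm.  In the plane `E = ℂ` the space of `k`-vectors is

* `ℝ` for `k = 0`,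
* `ℂ` for `k = 1`,
* `ℝ` for `k = 2`, the number `a` standing for the bivector `a • (e₁ ∧ e₂)`, where `e₁ = 1` and
  `e₂ = I`.

All these `k`-vectors are simple, so that the mass norm is the usual norm. -/

namespace DiffChain

section Pointed

variable {E V W : Type*} [NormedAddCommGroup E] [NormedSpace ℝ E]
  [NormedAddCommGroup V] [NormedSpace ℝ V] [NormedAddCommGroup W] [NormedSpace ℝ W]

/-- The translation operator `T_u` on pointed chains, i.e. on finitely supported `V`-valued
functions on `E`; the pointed chain `(p; α)` is `Finsupp.single p α`. -/
def translate (u : E) : (E →₀ V) →ₗ[ℝ] (E →₀ V) :=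
  Finsupp.lmapDomain V ℝ (fun p => p + u)

/-- The difference operator `Δ_u = T_u - Id`. -/
def diff (u : E) : (E →₀ V) →ₗ[ℝ] (E →₀ V) :=
  translate u - LinearMap.id

/-- The iterated difference operator `Δ_U` of a finite list `U` of vectors. -/
def diffs : List E → (E →₀ V) →ₗ[ℝ] (E →₀ V)
  | [] => LinearMap.id
  | u :: U => diff u ∘ₗ diffs U

variable (E V) in
/-- The data `(U, p, α)` of a difference chain `Δ_U (p; α)`. -/
structure DiffElem where
  dirs : List E
  point : E
  vec : V

/-- The pointed chain `Δ_U (p; α)`. -/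
def DiffElem.chain (t : DiffElem E V) : E →₀ V :=
  diffs t.dirs (Finsupp.single t.point t.vec)

/-- The number `|Δ_U (p; α)| = ‖u₁‖ ⋯ ‖u_j‖ ‖α‖`. -/
def DiffElem.size (t : DiffElem E V) : ℝ :=
  (t.dirs.map fun u => ‖u‖).prod * ‖t.vec‖

/-- `L` is a way of writing `A` as a finite sum of difference chains of order at most `r`. -/
def IsRep (r : ℕ) (A : E →₀ V) (L : List (DiffElem E V)) : Prop :=
  (∀ t ∈ L, t.dirs.length ≤ r) ∧ (L.map DiffElem.chain).sum = A

/-- The `r`-norm of a pointed chain; for `r = 0` this is the mass norm. -/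
def normB (r : ℕ) (A : E →₀ V) : ℝ :=
  sInf {c : ℝ | ∃ L : List (DiffElem E V), IsRep r A L ∧ c = (L.map DiffElem.size).sum}

theorem DiffElem.size_nonneg (t : DiffElem E V) : 0 ≤ t.size := by
  refine mul_nonneg (List.prod_nonneg ?_) (norm_nonneg _)
  simp only [List.mem_map]
  rintro _ ⟨u, -, rfl⟩
  exact norm_nonneg u

theorem sum_size_nonneg (L : List (DiffElem E V)) : 0 ≤ (L.map DiffElem.size).sum := by
  refine List.sum_nonneg ?_
  simp only [List.mem_map]
  rintro _ ⟨t, -, rfl⟩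
  exact t.size_nonneg

theorem exists_isRep (r : ℕ) (A : E →₀ V) : ∃ L : List (DiffElem E V), IsRep r A L := by
  induction A using Finsupp.induction_linear with
  | zero => exact ⟨[], by simp [IsRep]⟩
  | add f g hf hg =>
    obtain ⟨L, hL⟩ := hf
    obtain ⟨M, hM⟩ := hg
    refine ⟨L ++ M, ?_, by simp [hL.2, hM.2]⟩
    intro t ht
    rcases List.mem_append.1 ht with h | h
    · exact hL.1 t h
    · exact hM.1 t h
  | single p α => exact ⟨[⟨[], p, α⟩], by simp [IsRep, DiffElem.chain, diffs]⟩

theorem normB_nonneg (r : ℕ) (A : E →₀ V) : 0 ≤ normB r A := by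
  refine Real.sInf_nonneg ?_
  rintro _ ⟨L, -, rfl⟩
  exact sum_size_nonneg L

theorem normB_le {r : ℕ} {A : E →₀ V} {L : List (DiffElem E V)} (h : IsRep r A L) :
    normB r A ≤ (L.map DiffElem.size).sum := by
  refine csInf_le ⟨0, ?_⟩ ⟨L, h, rfl⟩
  rintro _ ⟨M, -, rfl⟩
  exact sum_size_nonneg M

/-- A lower bound on the size of all representations is a lower bound on the `r`-norm. -/
theorem le_normB {r : ℕ} {A : E →₀ V} {x : ℝ}
    (h : ∀ L, IsRep r A L → x ≤ (L.map DiffElem.size).sum) : x ≤ normB r A := by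
  obtain ⟨L, hL⟩ := exists_isRep r A
  refine le_csInf ⟨_, L, hL, rfl⟩ ?_
  rintro _ ⟨M, hM, rfl⟩
  exact h M hM

theorem normB_chain_le {r : ℕ} {t : DiffElem E V} (h : t.dirs.length ≤ r) :
    normB r t.chain ≤ t.size := by
  have : IsRep r t.chain [t] := by simp [IsRep, h]
  simpa using normB_le this

theorem normB_add_le (r : ℕ) (A B : E →₀ V) : normB r (A + B) ≤ normB r A + normB r B := by
  rw [← sub_le_iff_le_add']
  refine le_normB fun M hM => ?_
  rw [sub_le_comm]
  refine le_normB fun L hL => ?_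
  rw [sub_le_iff_le_add]
  have : IsRep r (A + B) (L ++ M) := by
    refine ⟨?_, by simp [hL.2, hM.2]⟩
    intro t ht
    rcases List.mem_append.1 ht with h | h
    · exact hL.1 t h
    · exact hM.1 t h
  simpa using normB_le this

theorem normB_zero (r : ℕ) : normB r (0 : E →₀ V) = 0 := by
  have : IsRep r (0 : E →₀ V) [] := by simp [IsRep]
  exact le_antisymm (by simpa using normB_le this) (normB_nonneg _ _)

/-- To bound a linear map in the `r`-norm it suffices to bound it on difference chains. -/
theorem norm_le_of_chain_le {X : Type*} [SeminormedAddCommGroup X] {r : ℕ} {C : ℝ}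
    (T : (E →₀ V) →+ X)
    (h : ∀ t : DiffElem E V, t.dirs.length ≤ r → ‖T t.chain‖ ≤ C * t.size) (hC : 0 ≤ C)
    (A : E →₀ V) : ‖T A‖ ≤ C * normB r A := by
  have key : ∀ L : List (DiffElem E V), (∀ t ∈ L, t.dirs.length ≤ r) →
      ‖T (L.map DiffElem.chain).sum‖ ≤ C * (L.map DiffElem.size).sum := by
    intro L
    induction L with
    | nil => simp
    | cons t L ih =>
      intro hL
      simp only [List.map_cons, List.sum_cons, map_add, mul_add]
      refine (norm_add_le _ _).trans (add_le_add (h t (hL t (by simp))) (ih ?_))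
      exact fun s hs => hL s (by simp [hs])
  rcases hC.eq_or_lt with rfl | hC
  · obtain ⟨L, hL⟩ := exists_isRep r A
    simpa [hL.2] using key L hL.1
  · rw [← div_le_iff₀' hC]
    refine le_normB fun L hL => ?_
    rw [div_le_iff₀' hC, ← hL.2]
    exact key L hL.1

end Pointed

section Chain

variable (E V : Type*) [NormedAddCommGroup E] [NormedSpace ℝ E]
  [NormedAddCommGroup V] [NormedSpace ℝ V]

/-- The space of pointed chains, to be endowed with the `r`-norm. -/
def PChain (_r : ℕ) : Type _ := E →₀ V

instance (r : ℕ) : AddCommGroup (PChain E V r) := inferInstanceAs (AddCommGroup (E →₀ V))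

instance (r : ℕ) : Module ℝ (PChain E V r) := inferInstanceAs (Module ℝ (E →₀ V))

instance (r : ℕ) : Norm (PChain E V r) := ⟨fun A => normB r (A : E →₀ V)⟩

variable {E V}

theorem diffElem_smul (c : ℝ) (t : DiffElem E V) :
    (⟨t.dirs, t.point, c • t.vec⟩ : DiffElem E V).chain = c • t.chain := by
  simp [DiffElem.chain, ← Finsupp.smul_single]

theorem normB_smul_le (r : ℕ) (c : ℝ) (A : E →₀ V) : normB r (c • A) ≤ |c| * normB r A := by
  have key : ∀ L, IsRep r A L → normB r (c • A) ≤ |c| * (L.map DiffElem.size).sum := by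
    intro L hL
    let M : List (DiffElem E V) := L.map fun t => ⟨t.dirs, t.point, c • t.vec⟩
    have hM : IsRep r (c • A) M := by
      refine ⟨?_, ?_⟩
      · intro t ht
        obtain ⟨s, hs, rfl⟩ := List.mem_map.1 ht
        exact hL.1 s hs
      · rw [← hL.2, List.smul_sum]
        simp only [M, List.map_map]
        congr 2
        funext t
        exact diffElem_smul c t
    refine (normB_le hM).trans (le_of_eq ?_)
    rw [← List.sum_map_mul_left]
    simp only [M, List.map_map]
    congr 2
    funext t
    simp only [Function.comp, DiffElem.size, norm_smul, Real.norm_eq_abs]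
    ring
  rcases (abs_nonneg c).eq_or_lt with hc | hc
  · obtain ⟨L, hL⟩ := exists_isRep r A
    simpa [← hc] using key L hL
  · rw [← div_le_iff₀' hc]
    refine le_normB fun L hL => ?_
    rw [div_le_iff₀' hc]
    exact key L hL

theorem normB_smul (r : ℕ) (c : ℝ) (A : E →₀ V) : normB r (c • A) = |c| * normB r A := by
  refine le_antisymm (normB_smul_le r c A) ?_
  rcases eq_or_ne c 0 with rfl | hc
  · simp [normB_nonneg]
  · have h := normB_smul_le r c⁻¹ (c • A)
    rw [smul_smul, inv_mul_cancel₀ hc, one_smul, abs_inv] at h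
    rwa [← div_eq_inv_mul, le_div_iff₀' (abs_pos.2 hc)] at h

variable (E V) in
theorem seminormCore (r : ℕ) : SeminormedSpace.Core ℝ (PChain E V r) where
  norm_nonneg A := normB_nonneg r (A : E →₀ V)
  norm_smul c A := normB_smul r c (A : E →₀ V)
  norm_triangle A B := normB_add_le r (A : E →₀ V) (B : E →₀ V)

instance (r : ℕ) : SeminormedAddCommGroup (PChain E V r) :=
  SeminormedAddCommGroup.ofCore (seminormCore E V r)

instance (r : ℕ) : NormedSpace ℝ (PChain E V r) where
  norm_smul_le c A := (normB_smul r c (A : E →₀ V)).le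

variable (E V) in
/-- The Banach space of differential chains of order `r`: the completion of the space of pointed
chains with respect to the `r`-norm. -/
abbrev Chain (r : ℕ) : Type _ := UniformSpace.Completion (PChain E V r)

/-- The differential chain given by a pointed chain. -/
def ofPointed (r : ℕ) : (E →₀ V) →ₗ[ℝ] Chain E V r :=
  (UniformSpace.Completion.toComplL (𝕜 := ℝ) (E := PChain E V r)).toLinearMap

theorem norm_ofPointed (r : ℕ) (A : E →₀ V) : ‖ofPointed r A‖ = normB r A :=
  UniformSpace.Completion.norm_coe (E := PChain E V r) A

/-- The continuous extension to differential chains of order `r` of a linear map on pointed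
chains that is bounded on difference chains. -/
def extendChain {X : Type*} [NormedAddCommGroup X] [NormedSpace ℝ X] [CompleteSpace X] (r : ℕ)
    (T : (E →₀ V) →ₗ[ℝ] X)
    (h : ∃ C : ℝ, 0 ≤ C ∧ ∀ t : DiffElem E V, t.dirs.length ≤ r → ‖T t.chain‖ ≤ C * t.size) :
    Chain E V r →L[ℝ] X :=
  ContinuousLinearMap.extend
    (LinearMap.mkContinuousOfExistsBound (E := PChain E V r) T
      (h.imp fun _ hC => norm_le_of_chain_le T.toAddMonoidHom hC.2 hC.1))
    (UniformSpace.Completion.toComplL (𝕜 := ℝ) (E := PChain E V r))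

theorem extendChain_ofPointed {X : Type*} [NormedAddCommGroup X] [NormedSpace ℝ X]
    [CompleteSpace X] (r : ℕ) (T : (E →₀ V) →ₗ[ℝ] X)
    (h : ∃ C : ℝ, 0 ≤ C ∧ ∀ t : DiffElem E V, t.dirs.length ≤ r → ‖T t.chain‖ ≤ C * t.size)
    (A : E →₀ V) : extendChain r T h (ofPointed r A) = T A :=
  ContinuousLinearMap.extend_eq (E := PChain E V r) _ UniformSpace.Completion.denseRange_coe
    (UniformSpace.Completion.isUniformInducing_coe _) (A : PChain E V r)

/-- The identity map on pointed chains extends to the natural map from chains of order `r` to chains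
of order `s`, for `r ≤ s`. -/
def incl {r s : ℕ} (h : r ≤ s) : Chain E V r →L[ℝ] Chain E V s :=
  extendChain r (ofPointed s) ⟨1, zero_le_one, fun t ht => by
    rw [norm_ofPointed, one_mul]
    exact normB_chain_le (ht.trans h)⟩

/-- A linear map of coefficients, applied at each point of a chain. -/
def mapCoeff {W : Type*} [NormedAddCommGroup W] [NormedSpace ℝ W] (r : ℕ) (T : V →L[ℝ] W) :
    Chain E V r →L[ℝ] Chain E W r :=
  extendChain r (ofPointed r ∘ₗ Finsupp.mapRange.linearMap T.toLinearMap)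
    ⟨‖T‖, norm_nonneg T, fun t ht => by
      have hc : ∀ U : List E, Finsupp.mapRange.linearMap (α := E) T.toLinearMap
          (diffs U (Finsupp.single t.point t.vec)) = diffs U (Finsupp.single t.point (T t.vec)) := by
        intro U
        induction U with
        | nil => simp [diffs]
        | cons u U ih =>
          have hcomm : ∀ B : E →₀ V, Finsupp.mapRange.linearMap (α := E) T.toLinearMap (diff u B) =
              diff u (Finsupp.mapRange.linearMap (α := E) T.toLinearMap B) := by
            intro B
            induction B using Finsupp.induction_linear with
            | zero => simp
            | add f g hf hg => simp only [map_add, hf, hg]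
            | single p α =>
              have hs : ∀ q : E, Finsupp.mapRange.linearMap (α := E) T.toLinearMap
                  (Finsupp.single q α) = Finsupp.single q (T α) := fun q => by simp
              simp only [diff, translate, Finsupp.lmapDomain_apply, LinearMap.sub_apply,
                LinearMap.id_apply, Finsupp.mapDomain_single, map_sub, hs]
          simp only [diffs, LinearMap.comp_apply, hcomm, ih]
      have hle : normB r (diffs t.dirs (Finsupp.single t.point (T t.vec))) ≤
          (⟨t.dirs, t.point, T t.vec⟩ : DiffElem E W).size :=
        normB_chain_le (t := ⟨t.dirs, t.point, T t.vec⟩) ht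
      rw [LinearMap.comp_apply, norm_ofPointed, DiffElem.chain, hc]
      refine hle.trans ?_
      have hp : 0 ≤ (t.dirs.map fun u => ‖u‖).prod := by
        refine List.prod_nonneg ?_
        simp only [List.mem_map]
        rintro _ ⟨u, -, rfl⟩
        exact norm_nonneg u
      calc (t.dirs.map fun u => ‖u‖).prod * ‖T t.vec‖
          ≤ (t.dirs.map fun u => ‖u‖).prod * (‖T‖ * ‖t.vec‖) :=
            mul_le_mul_of_nonneg_left (T.le_opNorm _) hp
        _ = ‖T‖ * t.size := by rw [DiffElem.size]; ring⟩

end Chain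

section Prederivative

variable {E V : Type*} [NormedAddCommGroup E] [NormedSpace ℝ E]
  [NormedAddCommGroup V] [NormedSpace ℝ V]

theorem normB_diff_le {s t : ℕ} (h : s < t) (u : E) (A : E →₀ V) :
    normB t (diff u A) ≤ ‖u‖ * normB s A := by
  have := norm_le_of_chain_le (r := s) (C := ‖u‖)
    ((ofPointed (E := E) (V := V) t) ∘ₗ diff u).toAddMonoidHom (fun x hx => ?_) (norm_nonneg u) A
  · simpa [norm_ofPointed] using this
  · have hx' : (u :: x.dirs).length ≤ t := by simp; omega
    have := normB_chain_le (t := (⟨u :: x.dirs, x.point, x.vec⟩ : DiffElem E V)) hx'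
    have h2 : (⟨u :: x.dirs, x.point, x.vec⟩ : DiffElem E V).size = ‖u‖ * x.size := by
      simp [DiffElem.size, mul_assoc]
    rw [h2] at this
    refine le_trans (le_of_eq ?_) this
    exact norm_ofPointed t _

theorem diff_add (a b : E) (A : E →₀ V) :
    diff (a + b) A - diff a A - diff b A = diff a (diff b A) := by
  have h : translate (a + b) A = translate a (translate b A) := by
    induction A using Finsupp.induction_linear with
    | zero => simp
    | add f g hf hg => simp only [map_add, hf, hg]
    | single p α => simp [translate, Finsupp.lmapDomain, add_assoc, add_comm a b]
  simp only [diff, LinearMap.sub_apply, LinearMap.id_apply, h, map_sub]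
  abel

/-- A function that is additive up to a quadratic error and at most linear has a derivative
at `0`. -/
theorem exists_tendsto_slope {X : Type*} [NormedAddCommGroup X] [NormedSpace ℝ X]
    [CompleteSpace X] (g : ℝ → X) (C D : ℝ)
    (h2 : ∀ a b, ‖g (a + b) - g a - g b‖ ≤ C * (|a| * |b|)) (h1 : ∀ a, ‖g a‖ ≤ D * |a|) :
    ∃ L, Tendsto (fun h : ℝ => h⁻¹ • g h) (𝓝[≠] 0) (𝓝 L) := by
  let u : ℝ → ℕ → X := fun x n => (2 : ℝ) ^ n • g (x / 2 ^ n)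
  have hu : ∀ x n, dist (u x n) (u x (n + 1)) ≤ (C * x ^ 2 / 4) * (1 / 2) ^ n := by
    intro x n
    have e : u x n - u x (n + 1) = (2 : ℝ) ^ n •
        (g (x / 2 ^ (n + 1) + x / 2 ^ (n + 1)) - g (x / 2 ^ (n + 1)) - g (x / 2 ^ (n + 1))) := by
      have : x / 2 ^ (n + 1) + x / 2 ^ (n + 1) = x / 2 ^ n := by field_simp; ring
      simp only [u, this]
      module
    rw [dist_eq_norm, e, norm_smul]
    refine (mul_le_mul_of_nonneg_left (h2 _ _) (norm_nonneg _)).trans (le_of_eq ?_)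
    rw [abs_mul_abs_self]
    simp only [norm_pow, Real.norm_ofNat]
    have h4 : ((1 : ℝ) / 2) ^ n = 1 / 2 ^ n := by simp
    rw [h4]
    field_simp
    ring
  have hlim : ∀ x, ∃ l, Tendsto (u x) atTop (𝓝 l) := fun x =>
    cauchySeq_tendsto_of_complete (cauchySeq_of_le_geometric _ _ (by norm_num) (hu x))
  choose G hG using hlim
  have hGg : ∀ x, ‖g x - G x‖ ≤ C / 2 * x ^ 2 := by
    intro x
    have := dist_le_of_le_geometric_of_tendsto₀ _ _ (by norm_num) (hu x) (hG x)
    rw [dist_eq_norm] at this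
    simp only [u, pow_zero, div_one, one_smul] at this
    refine this.trans (le_of_eq ?_)
    ring
  have hadd : ∀ x y, G (x + y) = G x + G y := by
    intro x y
    have l1 : Tendsto (fun n => u (x + y) n - u x n - u y n) atTop
        (𝓝 (G (x + y) - G x - G y)) := ((hG _).sub (hG _)).sub (hG _)
    have l2 : Tendsto (fun n => u (x + y) n - u x n - u y n) atTop (𝓝 0) := by
      refine squeeze_zero_norm (a := fun n => (C * (|x| * |y|)) * (1 / 2) ^ n) ?_ ?_
      · intro n
        have e : u (x + y) n - u x n - u y n = (2 : ℝ) ^ n •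
            (g (x / 2 ^ n + y / 2 ^ n) - g (x / 2 ^ n) - g (y / 2 ^ n)) := by
          simp only [u, add_div]
          module
        rw [e, norm_smul]
        refine (mul_le_mul_of_nonneg_left (h2 _ _) (norm_nonneg _)).trans (le_of_eq ?_)
        simp only [norm_pow, Real.norm_ofNat, abs_div, abs_pow, Nat.abs_ofNat]
        have h4 : ((1 : ℝ) / 2) ^ n = 1 / 2 ^ n := by simp
        rw [h4]
        field_simp
      · simpa using (tendsto_pow_atTop_nhds_zero_of_lt_one (r := (1 / 2 : ℝ))
          (by norm_num) (by norm_num)).const_mul (C * (|x| * |y|))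
    have := tendsto_nhds_unique l1 l2
    rw [sub_sub, sub_eq_zero] at this
    exact this
  have hbd : ∀ x, ‖G x‖ ≤ D * |x| := by
    intro x
    refine le_of_tendsto (hG x).norm (Eventually.of_forall fun n => ?_)
    simp only [u, norm_smul, norm_pow, Real.norm_ofNat]
    refine (mul_le_mul_of_nonneg_left (h1 _) (by positivity)).trans (le_of_eq ?_)
    simp only [abs_div, abs_pow, Nat.abs_ofNat]
    field_simp
  let G' : ℝ →+ X := AddMonoidHom.mk' G hadd
  have hcont : Continuous G' := by
    refine AddMonoidHomClass.continuous_of_bound G' D fun x => ?_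
    exact hbd x
  have hlin : ∀ x : ℝ, G x = x • G 1 := by
    intro x
    have := map_real_smul G' hcont x 1
    simpa [G'] using this
  refine ⟨G 1, ?_⟩
  rw [tendsto_iff_norm_sub_tendsto_zero]
  have hz : Tendsto (fun h : ℝ => C / 2 * |h|) (𝓝[≠] 0) (𝓝 0) := by
    have : Tendsto (fun h : ℝ => C / 2 * |h|) (𝓝 0) (𝓝 (C / 2 * |(0 : ℝ)|)) :=
      (continuous_const.mul continuous_abs).tendsto 0
    simp only [abs_zero, mul_zero] at this
    exact this.mono_left nhdsWithin_le_nhds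
  refine squeeze_zero' (Eventually.of_forall fun _ => norm_nonneg _) ?_ hz
  filter_upwards [self_mem_nhdsWithin] with h hh
  have hh : h ≠ 0 := hh
  have e : h⁻¹ • g h - G 1 = h⁻¹ • (g h - G h) := by
    rw [smul_sub, hlin h, smul_smul, inv_mul_cancel₀ hh, one_smul]
  rw [e, norm_smul]
  refine (mul_le_mul_of_nonneg_left (hGg h) (norm_nonneg _)).trans (le_of_eq ?_)
  rw [← sq_abs h, norm_inv, Real.norm_eq_abs]
  have : |h| ≠ 0 := abs_ne_zero.2 hh
  field_simp

/-- The prederivative `P_v A = lim_{h → 0} h⁻¹ Δ_{hv} A` of a pointed chain. -/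
def prederivPointed (t : ℕ) (v : E) (A : E →₀ V) : Chain E V t :=
  limUnder (𝓝[≠] (0 : ℝ)) fun h => ofPointed t (h⁻¹ • diff (h • v) A)

theorem tendsto_prederivPointed {t : ℕ} (ht : 2 ≤ t) (v : E) (A : E →₀ V) :
    Tendsto (fun h : ℝ => ofPointed t (h⁻¹ • diff (h • v) A)) (𝓝[≠] 0)
      (𝓝 (prederivPointed t v A)) := by
  have h2 : ∀ a b : ℝ, ‖ofPointed t (diff ((a + b) • v) A) - ofPointed t (diff (a • v) A) -
      ofPointed t (diff (b • v) A)‖ ≤ ‖v‖ * ‖v‖ * normB 0 A * (|a| * |b|) := by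
    intro a b
    simp only [add_smul]
    rw [← map_sub, ← map_sub, diff_add, norm_ofPointed]
    have h1 := normB_diff_le (show 1 < t by omega) (a • v) (diff (b • v) A)
    have h2 := normB_diff_le (show 0 < 1 by omega) (b • v) A
    refine (h1.trans (mul_le_mul_of_nonneg_left h2 (norm_nonneg _))).trans (le_of_eq ?_)
    simp only [norm_smul, Real.norm_eq_abs]
    ring
  have h1 : ∀ a : ℝ, ‖ofPointed t (diff (a • v) A)‖ ≤ ‖v‖ * normB 0 A * |a| := by
    intro a
    rw [norm_ofPointed]
    refine (normB_diff_le (show 0 < t by omega) (a • v) A).trans (le_of_eq ?_)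
    simp only [norm_smul, Real.norm_eq_abs]
    ring
  obtain ⟨L, hL⟩ := exists_tendsto_slope (fun h : ℝ => ofPointed t (diff (h • v) A)) _ _ h2 h1
  exact tendsto_nhds_limUnder ⟨L, by simpa using hL⟩

theorem norm_prederivPointed_le {s t : ℕ} (h : s < t) (ht : 2 ≤ t) (v : E) (A : E →₀ V) :
    ‖prederivPointed t v A‖ ≤ ‖v‖ * normB s A := by
  refine le_of_tendsto (tendsto_prederivPointed ht v A).norm ?_
  filter_upwards [self_mem_nhdsWithin] with x hx
  have hx : x ≠ 0 := hx
  rw [norm_ofPointed, normB_smul]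
  refine (mul_le_mul_of_nonneg_left (normB_diff_le h (x • v) A) (abs_nonneg _)).trans
    (le_of_eq ?_)
  have : |x| ≠ 0 := abs_ne_zero.2 hx
  rw [norm_smul, abs_inv, Real.norm_eq_abs]
  field_simp

/-- The prederivative as a linear map on pointed chains. -/
def prederivLinear {t : ℕ} (ht : 2 ≤ t) (v : E) : (E →₀ V) →ₗ[ℝ] Chain E V t where
  toFun := prederivPointed t v
  map_add' A B := by
    refine tendsto_nhds_unique (tendsto_prederivPointed ht v (A + B)) ?_
    simpa using (tendsto_prederivPointed ht v A).add (tendsto_prederivPointed ht v B)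
  map_smul' c A := by
    refine tendsto_nhds_unique (tendsto_prederivPointed ht v (c • A)) ?_
    simpa [smul_comm c] using (tendsto_prederivPointed ht v A).const_smul c

/-- The prederivative `P_v`, mapping chains of order `s` continuously to chains of order `t` for all
`t ≥ max (s + 1) 2`. -/
def prederiv {s t : ℕ} (h : s < t) (ht : 2 ≤ t) (v : E) : Chain E V s →L[ℝ] Chain E V t :=
  extendChain s (prederivLinear ht v) ⟨‖v‖, norm_nonneg v, fun x hx =>
    (norm_prederivPointed_le h ht v x.chain).trans
      (mul_le_mul_of_nonneg_left (normB_chain_le hx) (norm_nonneg v))⟩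

end Prederivative

section Plane

/-- Retraction `E_v^†` of `1`-vectors in the plane: `w ↦ ⟨v, w⟩`. -/
def retract₁ (r : ℕ) (v : ℂ) : Chain ℂ ℂ r →L[ℝ] Chain ℂ ℝ r :=
  mapCoeff r (innerSL ℝ v)

/-- Retraction `E_v^†` of `2`-vectors in the plane:
`a • (e₁ ∧ e₂) ↦ a • (⟨v, e₁⟩ e₂ - ⟨v, e₂⟩ e₁)`. -/
def retract₂ (r : ℕ) (v : ℂ) : Chain ℂ ℝ r →L[ℝ] Chain ℂ ℂ r :=
  mapCoeff r (ContinuousLinearMap.toSpanSingleton ℝ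
    (inner ℝ v 1 • Complex.I - inner ℝ v Complex.I • (1 : ℂ)))

/-- The boundary `∂ = P_{e₁} E_{e₁}^† + P_{e₂} E_{e₂}^†` of a `1`-chain in the plane. -/
def boundary₁ {s t : ℕ} (h : s < t) (ht : 2 ≤ t) : Chain ℂ ℂ s →L[ℝ] Chain ℂ ℝ t :=
  prederiv h ht (1 : ℂ) ∘L retract₁ s 1 + prederiv h ht Complex.I ∘L retract₁ s Complex.I

/-- The boundary `∂ = P_{e₁} E_{e₁}^† + P_{e₂} E_{e₂}^†` of a `2`-chain in the plane. -/
def boundary₂ {s t : ℕ} (h : s < t) (ht : 2 ≤ t) : Chain ℂ ℝ s →L[ℝ] Chain ℂ ℂ t :=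
  prederiv h ht (1 : ℂ) ∘L retract₂ s 1 + prederiv h ht Complex.I ∘L retract₂ s Complex.I

end Plane

section Support

variable {E V : Type*} [NormedAddCommGroup E] [NormedSpace ℝ E]
  [NormedAddCommGroup V] [NormedSpace ℝ V]

/-- The closed set `X` supports the chain `J` if, for every non-empty open `W ⊇ X`, the chain `J` is
a limit of pointed chains in `W`. -/
def Supports {r : ℕ} (X : Set E) (J : Chain E V r) : Prop :=
  ∀ W : Set E, IsOpen W → W.Nonempty → X ⊆ W →
    ∃ A : ℕ → (E →₀ V), (∀ i, ((A i).support : Set E) ⊆ W) ∧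
      Tendsto (fun i => ofPointed r (A i)) atTop (𝓝 J)

/-- The support of a chain: the intersection of all closed sets that support it. -/
def supp {r : ℕ} (J : Chain E V r) : Set E :=
  ⋂₀ {X : Set E | IsClosed X ∧ Supports X J}

/-- The mass of a chain. -/
def mass {r : ℕ} (K : Chain E V r) : ENNReal :=
  sInf {m : ENNReal | ∃ A : ℕ → (E →₀ V), Tendsto (fun i => ofPointed r (A i)) atTop (𝓝 K) ∧
    m = liminf (fun i => ENNReal.ofReal (normB 0 (A i))) atTop}

end Support

section Integral

variable {E V F : Type*} [NormedAddCommGroup E] [NormedSpace ℝ E]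
  [NormedAddCommGroup V] [NormedSpace ℝ V]
  [NormedAddCommGroup F] [NormedSpace ℝ F] [CompleteSpace F]

/-- Evaluation `ω(A) = ∑ ω_{p_i}(α_i)` of an `F`-valued form on a pointed chain. -/
def evalForm (ω : E → V →L[ℝ] F) : (E →₀ V) →ₗ[ℝ] F :=
  Finsupp.lsum ℝ fun p => (ω p).toLinearMap

/-- The form `ω` belongs to `𝓑^r`, i.e. it has finite `r`-norm: it is bounded on the difference
chains `Δ_U^j (p; α)` with `j ≤ r` and `|Δ_U^j (p; α)| = 1`. -/
def IsBForm (r : ℕ) (ω : E → V →L[ℝ] F) : Prop :=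
  ∃ C : ℝ, 0 ≤ C ∧ ∀ t : DiffElem E V, t.dirs.length ≤ r → ‖evalForm ω t.chain‖ ≤ C * t.size

/-- Integration of a form `ω ∈ 𝓑^r` over chains of order `r`: the continuous extension of the
evaluation of `ω` on pointed chains. -/
def integralB {r : ℕ} (ω : E → V →L[ℝ] F) (hω : IsBForm r ω) : Chain E V r →L[ℝ] F :=
  extendChain r (evalForm ω) hω

/-- The form `ω`, which matters only near the support of `J`, agrees there with the globally defined
form `η ∈ 𝓑^r`. -/
def IsExtension {r : ℕ} (J : Chain E V r) (ω η : E → V →L[ℝ] F) : Prop :=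
  IsBForm r η ∧ ∀ᶠ p in 𝓝ˢ (supp J), η p = ω p

/-- The form `ω` can be integrated over `J`: it agrees near the support of `J` with a form in
`𝓑^r`. -/
def Integrable {r : ℕ} (J : Chain E V r) (ω : E → V →L[ℝ] F) : Prop :=
  ∃ η, IsExtension J ω η

open scoped Classical in
/-- The integral over the chain `J` of a form `ω` defined near the support of `J`: it is the integral
of any form in `𝓑^r` which agrees with `ω` near the support (and `0` if there is none). -/
def integral {r : ℕ} (J : Chain E V r) (ω : E → V →L[ℝ] F) : F :=
  if h : Integrable J ω then integralB h.choose h.choose_spec.1 J else 0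

/-- The complex-valued `1`-form `f(z) dz`. -/
def formDz (f : ℂ → ℂ) : ℂ → ℂ →L[ℝ] ℂ :=
  fun z => f z • ContinuousLinearMap.id ℝ ℂ

/-- The winding number `Ind_J(z) = (2πi)⁻¹ ∫_J dw / (w - z)`, for `z` off the support of `J`. -/
def windingNumber {r : ℕ} (J : Chain ℂ ℂ r) (z : ℂ) : ℂ :=
  (2 * Real.pi * Complex.I)⁻¹ * integral J (formDz fun w => (w - z)⁻¹)

end Integral

end DiffChain

end

open Filter Topology

set_option linter.unusedSectionVars false

noncomputable section

/-! Let N consist of supp J together with the points off it where the index is non-zero. The index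
is locally constant off supp J, so N is closed; it lies in the bounded set U, hence is compact. Cut
f off to a smooth, compactly supported F that equals f near N. The Cauchy-Pompeiu formula
(`integral_dbar_div`) gives F(w) = π⁻¹ ∫ ∂̄F(z) / (w - z) over the plane, and ∂̄F vanishes near N.
Near supp J, the form f dw is therefore a superposition of kernels dw / (w - z) whose poles z have
index zero. `J` annihilates each kernel, hence also the superposition
(`integralB_integral_eq_zero`).

Two facts about chains are needed. Locality (`integralB_eq_zero`): an integral sees only the germ of
the form along supp J, although the intersection defining supp J is not known in advance to support
`J`. Stokes (`integralB_boundary₁`): a closed chain annihilates exact differentials; applied to a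
logarithm, this makes the index locally constant.

Both rest on a dictionary: 𝓑^r consists of the forms whose iterated differences up to order r are
bounded (`DiffBound.isBForm`, `IsBForm.exists_diffBound`). Smooth forms of compact support thus
belong to every 𝓑^r, and `DiffBound` carries the explicit constants that the limit arguments
require. -/

namespace DiffChain

/-! ### Iterated differences of functions -/

section Differences

variable {E F G : Type*} [NormedAddCommGroup E] [NormedAddCommGroup F] [NormedAddCommGroup G]

/-- The iterated difference of a function along a list of vectors. -/
def fwdDiffs : List E → (E → F) → E → F
  | [], f => f
  | u :: U, f => fwdDiffs U (fwdDiff u f)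

/-- All iterated differences of `f` of order at most `n` are bounded by `C` times the product of the
norms of the directions. -/
def DiffBound (n : ℕ) (C : ℝ) (f : E → F) : Prop :=
  ∀ U : List E, U.length ≤ n → ∀ p, ‖fwdDiffs U f p‖ ≤ C * (U.map fun u => ‖u‖).prod

theorem prod_norm_nonneg (U : List E) : 0 ≤ (U.map fun u => ‖u‖).prod := by
  refine List.prod_nonneg ?_
  simp only [List.mem_map]
  rintro _ ⟨u, -, rfl⟩
  exact norm_nonneg u

/-- Differences commute, so the first direction can be made the outermost one, where the mean value
inequality applies. -/
theorem fwdDiffs_fwdDiff (U : List E) (u : E) (f : E → F) :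
    fwdDiffs U (fwdDiff u f) = fwdDiff u (fwdDiffs U f) := by
  induction U generalizing f with
  | nil => rfl
  | cons v U ih =>
    have : fwdDiff v (fwdDiff u f) = fwdDiff u (fwdDiff v f) := by
      funext p
      simp only [fwdDiff, add_right_comm p u v]
      abel
    simp only [fwdDiffs, this, ih]

theorem fwdDiffs_add (U : List E) (f g : E → F) :
    fwdDiffs U (f + g) = fwdDiffs U f + fwdDiffs U g := by
  induction U generalizing f g with
  | nil => rfl
  | cons u U ih => simp only [fwdDiffs, fwdDiff_add, ih]

theorem fwdDiffs_comp (U : List E) (T : F →+ G) (f : E → F) (p : E) :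
    fwdDiffs U (fun q => T (f q)) p = T (fwdDiffs U f p) := by
  induction U generalizing f with
  | nil => rfl
  | cons u U ih =>
    have : fwdDiff u (fun q => T (f q)) = fun q => T (fwdDiff u f q) := by
      funext q
      simp [fwdDiff]
    simp only [fwdDiffs, this, ih]

theorem fwdDiffs_comp_add (U : List E) (f : E → F) (v p : E) :
    fwdDiffs U (fun q => f (q + v)) p = fwdDiffs U f (p + v) := by
  induction U generalizing f with
  | nil => rfl
  | cons u U ih =>
    have : fwdDiff u (fun q => f (q + v)) = fun q => fwdDiff u f (q + v) := by
      funext q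
      simp [fwdDiff, add_right_comm]
    simp only [fwdDiffs, this, ih]

/-- Differences of a function precomposed with an affine map. -/
theorem fwdDiffs_comp_affine {E' : Type*} [NormedAddCommGroup E'] (U : List E) (T : E →+ E')
    (c : E') (f : E' → F) (p : E) :
    fwdDiffs U (fun q => f (T q + c)) p = fwdDiffs (U.map T) f (T p + c) := by
  induction U generalizing f with
  | nil => rfl
  | cons u U ih =>
    have : fwdDiff u (fun q => f (T q + c)) = fun q => fwdDiff (T u) f (T q + c) := by
      funext q
      simp [fwdDiff, add_right_comm]
    simp only [fwdDiffs, List.map_cons, this, ih]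

/-- The directions only shrink under T, so the constant survives. This serves dilations of cutoffs
by factors at most 1 and the slices of a function on a product. -/
theorem DiffBound.comp_affine {E' : Type*} [NormedAddCommGroup E'] {n : ℕ} {C : ℝ} {f : E' → F}
    (h : DiffBound n C f) (hC : 0 ≤ C) (T : E →+ E') (hT : ∀ u, ‖T u‖ ≤ ‖u‖) (c : E') :
    DiffBound n C fun q => f (T q + c) := by
  intro U hU p
  rw [fwdDiffs_comp_affine]
  refine (h _ (by simpa using hU) _).trans (mul_le_mul_of_nonneg_left ?_ hC)
  rw [List.map_map]
  clear hU
  induction U with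
  | nil => simp
  | cons u U ih =>
    simp only [List.map_cons, List.prod_cons, Function.comp]
    refine mul_le_mul (hT u) ih ?_ (norm_nonneg _)
    rw [← List.map_map]
    exact prod_norm_nonneg _

theorem DiffBound.fwdDiff {n : ℕ} {C : ℝ} {f : E → F} (h : DiffBound (n + 1) C f) (u : E) :
    DiffBound n (C * ‖u‖) (fwdDiff u f) := by
  intro U hU p
  have := h (u :: U) (by simpa using hU) p
  simpa [fwdDiffs, mul_assoc] using this

theorem DiffBound.mono {m n : ℕ} {C : ℝ} {f : E → F} (h : DiffBound n C f) (hmn : m ≤ n) :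
    DiffBound m C f := fun U hU p => h U (hU.trans hmn) p

theorem DiffBound.shift {n : ℕ} {C : ℝ} {f : E → F} (h : DiffBound n C f) (v : E) :
    DiffBound n C fun q => f (q + v) := by
  intro U hU p
  rw [fwdDiffs_comp_add]
  exact h U hU _

theorem DiffBound.comp_clm [NormedSpace ℝ F] [NormedSpace ℝ G] {n : ℕ} {C : ℝ} {f : E → F}
    (h : DiffBound n C f) (T : F →L[ℝ] G) : DiffBound n (‖T‖ * C) fun q => T (f q) := by
  intro U hU p
  have := fwdDiffs_comp U (T : F →+ G) f p
  rw [show fwdDiffs U (fun q => T (f q)) p = T (fwdDiffs U f p) from this, mul_assoc]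
  exact (T.le_opNorm _).trans (mul_le_mul_of_nonneg_left (h U hU p) (norm_nonneg _))

theorem DiffBound.add {n : ℕ} {C D : ℝ} {f g : E → F} (hf : DiffBound n C f)
    (hg : DiffBound n D g) : DiffBound n (C + D) (f + g) := by
  intro U hU p
  rw [fwdDiffs_add, add_mul]
  exact (norm_add_le _ _).trans (add_le_add (hf U hU p) (hg U hU p))

/-- Leibniz rule for finite differences. -/
theorem DiffBound.smul [NormedSpace ℝ F] {n : ℕ} {C D : ℝ} {f : E → ℝ} {g : E → F}
    (hf : DiffBound n C f) (hg : DiffBound n D g) :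
    DiffBound n (2 ^ n * (C * D)) (f • g) := by
  -- The constants and functions stay free in the induction: each step differences one factor,
  -- replacing its constant by itself times ‖u‖, and the two terms of the product rule account for
  -- one factor 2.
  have key : ∀ n : ℕ, ∀ U : List E, U.length = n → ∀ (C D : ℝ) (f : E → ℝ) (g : E → F),
      DiffBound n C f → DiffBound n D g → ∀ p,
      ‖fwdDiffs U (f • g) p‖ ≤ 2 ^ n * (C * D) * (U.map fun u => ‖u‖).prod := by
    intro n
    induction n with
    | zero =>
      intro U hU C D f g hf hg p
      obtain rfl := List.length_eq_zero_iff.1 hU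
      have h1 := hf [] le_rfl p
      have h2 := hg [] le_rfl p
      simp only [fwdDiffs, List.map_nil, List.prod_nil, mul_one] at h1 h2
      simp only [fwdDiffs, List.map_nil, List.prod_nil, mul_one, pow_zero, one_mul, Pi.smul_apply',
        norm_smul]
      exact mul_le_mul h1 h2 (norm_nonneg _) ((norm_nonneg _).trans h1)
    | succ n ih =>
      intro U hU C D f g hf hg p
      obtain ⟨u, V, rfl⟩ := List.exists_cons_of_length_eq_add_one hU
      have hV : V.length = n := by simpa using hU
      have e : _root_.fwdDiff u (f • g) =
          _root_.fwdDiff u f • (fun q => g (q + u)) + f • _root_.fwdDiff u g := by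
        funext q
        simp only [_root_.fwdDiff, Pi.smul_apply', Pi.add_apply, sub_smul, smul_sub]
        abel
      simp only [fwdDiffs, e, fwdDiffs_add, List.map_cons, List.prod_cons]
      have h1 := ih V hV _ _ _ _ (hf.fwdDiff u) ((hg.mono n.le_succ).shift u) p
      have h2 := ih V hV _ _ _ _ (hf.mono n.le_succ) (hg.fwdDiff u) p
      refine (norm_add_le _ _).trans ((add_le_add h1 h2).trans (le_of_eq ?_))
      ring
  have hC : 0 ≤ C := by simpa [fwdDiffs] using (norm_nonneg _).trans (hf [] (by simp) 0)
  have hD : 0 ≤ D := by simpa [fwdDiffs] using (norm_nonneg _).trans (hg [] (by simp) 0)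
  intro U hU p
  refine (key _ U rfl C D f g (hf.mono hU) (hg.mono hU) p).trans ?_
  refine mul_le_mul_of_nonneg_right ?_ (prod_norm_nonneg U)
  refine mul_le_mul_of_nonneg_right ?_ (mul_nonneg hC hD)
  exact pow_le_pow_right₀ (by norm_num) hU

end Differences

/-! ### Difference bounds for smooth functions of compact support -/

section Smooth

open scoped ContDiff

universe u

theorem hasFDerivAt_fwdDiffs {E F : Type*} [NormedAddCommGroup E] [NormedSpace ℝ E]
    [NormedAddCommGroup F] [NormedSpace ℝ F] {f : E → F} {f' : E → E →L[ℝ] F}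
    (hf : ∀ p, HasFDerivAt f (f' p) p) (U : List E) (p : E) :
    HasFDerivAt (fwdDiffs U f) (fwdDiffs U f' p) p := by
  induction U generalizing f f' with
  | nil => exact hf p
  | cons u U ih =>
    refine ih fun q => ?_
    exact (hasFDerivAt_comp_add_right u |>.2 (hf (q + u))).sub (hf q)

/-- One difference is traded for one derivative by the mean value inequality. The induction passes
from f to its derivative, so the target space must vary. -/
theorem exists_bound_fwdDiffs {E : Type u} [NormedAddCommGroup E] [NormedSpace ℝ E] (n : ℕ) :
    ∀ {F : Type u} [NormedAddCommGroup F] [NormedSpace ℝ F] {f : E → F},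
      ContDiff ℝ ∞ f → HasCompactSupport f → ∃ C : ℝ, 0 ≤ C ∧
      ∀ U : List E, U.length = n → ∀ p, ‖fwdDiffs U f p‖ ≤ C * (U.map fun u => ‖u‖).prod := by
  induction n with
  | zero =>
    intro F _ _ f hf hc
    obtain ⟨C, hC⟩ := hc.exists_bound_of_continuous hf.continuous
    refine ⟨C, (norm_nonneg _).trans (hC 0), fun U hU p => ?_⟩
    obtain rfl := List.length_eq_zero_iff.1 hU
    simpa [fwdDiffs] using hC p
  | succ n ih =>
    intro F _ _ f hf hc
    have hdiff : Differentiable ℝ f := hf.differentiable (by simp)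
    obtain ⟨C, hC, h⟩ := ih (hf.fderiv_right (m := ∞) (by simp)) (hc.fderiv ℝ)
    refine ⟨C, hC, fun U hU p => ?_⟩
    obtain ⟨u, V, rfl⟩ := List.exists_cons_of_length_eq_add_one hU
    have hV : V.length = n := by simpa using hU
    have := Convex.norm_image_sub_le_of_norm_hasFDerivWithin_le (s := Set.univ)
      (fun x _ => (hasFDerivAt_fwdDiffs (fun q => (hdiff q).hasFDerivAt) V x).hasFDerivWithinAt)
      (fun x _ => h V hV x) convex_univ (Set.mem_univ p) (Set.mem_univ (p + u))
    simp only [fwdDiffs, fwdDiffs_fwdDiff, List.map_cons, List.prod_cons]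
    refine this.trans (le_of_eq ?_)
    rw [add_sub_cancel_left]
    ring

/-- Smooth functions of compact support have bounded difference quotients of all orders. -/
theorem exists_diffBound {E F : Type u} [NormedAddCommGroup E] [NormedSpace ℝ E]
    [NormedAddCommGroup F] [NormedSpace ℝ F] {f : E → F}
    (hf : ContDiff ℝ ∞ f) (hc : HasCompactSupport f) (n : ℕ) :
    ∃ C : ℝ, 0 ≤ C ∧ DiffBound n C f := by
  choose C hC h using fun n => exists_bound_fwdDiffs (E := E) n hf hc
  -- The sum dominates the constant for each exact number of differences up to n.
  refine ⟨∑ i ∈ Finset.range (n + 1), C i, Finset.sum_nonneg fun i _ => hC i, fun U hU p => ?_⟩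
  refine (h _ U rfl p).trans (mul_le_mul_of_nonneg_right ?_ (prod_norm_nonneg U))
  exact Finset.single_le_sum (fun i _ => hC i) (by simp; omega)

end Smooth

/-! ### Forms of class 𝓑^r and their integrals -/

section Forms

variable {E V F : Type*} [NormedAddCommGroup E] [NormedSpace ℝ E]
  [NormedAddCommGroup V] [NormedSpace ℝ V]
  [NormedAddCommGroup F] [NormedSpace ℝ F] [CompleteSpace F]

theorem evalForm_single (ω : E → V →L[ℝ] F) (p : E) (α : V) :
    evalForm ω (Finsupp.single p α) = ω p α := by
  simp [evalForm]

/-- Evaluation is a pairing for which the difference operators on chains and on forms are adjoint;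
this starts the dictionary between norms of chains and difference bounds of forms. -/
theorem evalForm_diff (ω : E → V →L[ℝ] F) (u : E) (A : E →₀ V) :
    evalForm ω (diff u A) = evalForm (fwdDiff u ω) A := by
  induction A using Finsupp.induction_linear with
  | zero => simp
  | add f g hf hg => simp only [map_add, hf, hg]
  | single p α =>
    simp [diff, translate, Finsupp.lmapDomain_apply, evalForm_single, fwdDiff]

theorem evalForm_diffs (ω : E → V →L[ℝ] F) (U : List E) (A : E →₀ V) :
    evalForm ω (diffs U A) = evalForm (fwdDiffs U ω) A := by
  induction U generalizing ω with
  | nil => rfl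
  | cons u U ih => simp only [diffs, LinearMap.comp_apply, evalForm_diff, ih, fwdDiffs]

theorem DiffBound.norm_evalForm_chain_le {n : ℕ} {C : ℝ} {ω : E → V →L[ℝ] F}
    (h : DiffBound n C ω) (t : DiffElem E V) (ht : t.dirs.length ≤ n) :
    ‖evalForm ω t.chain‖ ≤ C * t.size := by
  rw [DiffElem.chain, evalForm_diffs, evalForm_single, DiffElem.size, ← mul_assoc]
  exact ((fwdDiffs t.dirs ω t.point).le_opNorm _).trans
    (mul_le_mul_of_nonneg_right (h _ ht _) (norm_nonneg _))

theorem DiffBound.isBForm {n : ℕ} {C : ℝ} {ω : E → V →L[ℝ] F}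
    (hC : 0 ≤ C) (h : DiffBound n C ω) : IsBForm n ω :=
  ⟨C, hC, h.norm_evalForm_chain_le⟩

/-- Testing the form on a single difference chain, with its vector free, recovers the operator norm
of the iterated difference. -/
theorem IsBForm.exists_diffBound {n : ℕ} {ω : E → V →L[ℝ] F} (h : IsBForm n ω) :
    ∃ C, 0 ≤ C ∧ DiffBound n C ω := by
  obtain ⟨C, hC, h⟩ := h
  refine ⟨C, hC, fun U hU p => ?_⟩
  refine ContinuousLinearMap.opNorm_le_bound _ (mul_nonneg hC (prod_norm_nonneg U)) fun α => ?_
  have := h ⟨U, p, α⟩ hU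
  rwa [DiffElem.chain, evalForm_diffs, evalForm_single, DiffElem.size, ← mul_assoc] at this

theorem integralB_ofPointed {n : ℕ} {ω : E → V →L[ℝ] F} (h : IsBForm n ω) (A : E →₀ V) :
    integralB ω h (ofPointed n A) = evalForm ω A :=
  extendChain_ofPointed n _ h A

theorem chain_induction {n : ℕ} {P : Chain E V n → Prop} (hP : IsClosed {J | P J})
    (h : ∀ A : E →₀ V, P (ofPointed n A)) (J : Chain E V n) : P J :=
  UniformSpace.Completion.induction_on J hP h

theorem exists_tendsto_ofPointed {n : ℕ} (J : Chain E V n) :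
    ∃ A : ℕ → (E →₀ V), Tendsto (fun i => ofPointed n (A i)) atTop (𝓝 J) := by
  have hd : DenseRange (ofPointed (E := E) (V := V) n) :=
    UniformSpace.Completion.denseRange_coe (α := PChain E V n)
  obtain ⟨x, hx, hlim⟩ := mem_closure_iff_seq_limit.1 (hd J)
  choose A hA using hx
  exact ⟨A, by simpa only [hA] using hlim⟩

/-- The constant is that of the difference bound, so the estimate is uniform over families of forms
sharing one bound. -/
theorem norm_integralB_le {n : ℕ} {C : ℝ} {ω : E → V →L[ℝ] F} (hC : 0 ≤ C) (hω : DiffBound n C ω)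
    (h : IsBForm n ω) (J : Chain E V n) : ‖integralB ω h J‖ ≤ C * ‖J‖ := by
  induction J using chain_induction with
  | hP =>
    exact isClosed_le (integralB ω h).continuous.norm (continuous_const.mul continuous_norm)
  | h A =>
    rw [integralB_ofPointed, norm_ofPointed]
    exact norm_le_of_chain_le (evalForm ω).toAddMonoidHom hω.norm_evalForm_chain_le hC A

theorem evalForm_add (ω η : E → V →L[ℝ] F) (A : E →₀ V) :
    evalForm (ω + η) A = evalForm ω A + evalForm η A := by
  induction A using Finsupp.induction_linear with
  | zero => simp
  | add f g hf hg => simp only [map_add, hf, hg]; abel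
  | single p α => simp [evalForm_single]

theorem evalForm_congr {ω η : E → V →L[ℝ] F} {A : E →₀ V}
    (h : ∀ p ∈ A.support, ω p = η p) : evalForm ω A = evalForm η A := by
  simp only [evalForm, Finsupp.lsum_apply, Finsupp.sum]
  exact Finset.sum_congr rfl fun p hp => by rw [h p hp]

theorem IsBForm.add {n : ℕ} {ω η : E → V →L[ℝ] F} (hω : IsBForm n ω) (hη : IsBForm n η) :
    IsBForm n (ω + η) := by
  obtain ⟨C, hC, h⟩ := hω.exists_diffBound
  obtain ⟨D, hD, h'⟩ := hη.exists_diffBound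
  exact (h.add h').isBForm (add_nonneg hC hD)

theorem integralB_add {n : ℕ} {ω η : E → V →L[ℝ] F} (hω : IsBForm n ω) (hη : IsBForm n η)
    (h : IsBForm n (ω + η)) (J : Chain E V n) :
    integralB (ω + η) h J = integralB ω hω J + integralB η hη J := by
  induction J using chain_induction with
  | hP =>
    exact isClosed_eq (integralB _ h).continuous
      ((integralB _ hω).continuous.add (integralB _ hη).continuous)
  | h A => simp only [integralB_ofPointed, evalForm_add]

end Forms

open scoped ContDiff

/-! ### Integrals depend only on the form near the support -/

section Locality

theorem exists_cutoff {K U : Set ℂ} (hK : IsCompact K) (hU : IsOpen U) (h : K ⊆ U) :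
    ∃ χ : ℂ → ℝ, ContDiff ℝ ∞ χ ∧ HasCompactSupport χ ∧ tsupport χ ⊆ U ∧
      ∀ᶠ p in 𝓝ˢ K, χ p = 1 := by
  obtain ⟨L, hL, hKL, hLU⟩ := exists_compact_between hK hU h
  obtain ⟨χ, h1, h0, -⟩ := exists_contMDiffMap_one_nhds_of_subset_interior
    (modelWithCornersSelf ℝ ℂ) (n := ⊤) hK.isClosed hKL
  have hs : tsupport χ ⊆ L := closure_minimal
    (fun x hx => by_contra fun hxL => hx (h0 x hxL)) hL.isClosed
  exact ⟨χ, χ.contMDiff.contDiff, HasCompactSupport.of_support_subset_isCompact hL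
    (subset_closure.trans hs), hs.trans hLU, h1⟩

variable {V F : Type*} [NormedAddCommGroup V] [NormedSpace ℝ V]
  [NormedAddCommGroup F] [NormedSpace ℝ F] [CompleteSpace F]

theorem IsBForm.smul {n : ℕ} {χ : ℂ → ℝ} (hχ : ContDiff ℝ ∞ χ) (hc : HasCompactSupport χ)
    {η : ℂ → V →L[ℝ] F} (hη : IsBForm n η) : IsBForm n (χ • η) := by
  obtain ⟨C, hC, h⟩ := DiffChain.exists_diffBound hχ hc n
  obtain ⟨D, hD, h'⟩ := hη.exists_diffBound
  exact (h.smul h').isBForm (by positivity)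

theorem integralB_congr {n : ℕ} {η η' : ℂ → V →L[ℝ] F} (h : η = η') (hη : IsBForm n η)
    (hη' : IsBForm n η') (J : Chain ℂ V n) : integralB η hη J = integralB η' hη' J := by
  subst h
  rfl

theorem integralB_eq_of_tendsto {n : ℕ} {η : ℂ → V →L[ℝ] F} (hη : IsBForm n η)
    {J : Chain ℂ V n} {A : ℕ → (ℂ →₀ V)} {a : F}
    (hA : Tendsto (fun i => ofPointed n (A i)) atTop (𝓝 J))
    (h : Tendsto (fun i => evalForm η (A i)) atTop (𝓝 a)) : integralB η hη J = a := by
  refine tendsto_nhds_unique (((integralB η hη).continuous.tendsto J).comp hA) ?_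
  simpa only [Function.comp_def, integralB_ofPointed] using h

/-- A form vanishing on a neighbourhood of a supporting set integrates to zero. -/
theorem Supports.integralB_eq_zero {n : ℕ} {J : Chain ℂ V n} {X W : Set ℂ} (hX : Supports X J)
    (hW : IsOpen W) (hne : W.Nonempty) (hXW : X ⊆ W) {η : ℂ → V →L[ℝ] F} (hη : IsBForm n η)
    (h : ∀ p ∈ W, η p = 0) : integralB η hη J = 0 := by
  obtain ⟨A, hA, hlim⟩ := hX W hW hne hXW
  refine integralB_eq_of_tendsto hη hlim ?_
  have : ∀ i, evalForm η (A i) = 0 := fun i => by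
    rw [evalForm_congr (η := 0) fun p hp => h p (hA i hp)]
    simp [evalForm, Finsupp.sum]
  simp [this]

/-- A cutoff function that equals one near a given compact set off the support, and annihilates the
chain. -/
theorem exists_annihilating_cutoff {n : ℕ} (J : Chain ℂ V n) {S : Set ℂ} (hS : IsCompact S)
    (hd : S ⊆ (supp J)ᶜ) (F : Type*) [NormedAddCommGroup F] [NormedSpace ℝ F] [CompleteSpace F] :
    ∃ χ : ℂ → ℝ, ContDiff ℝ ∞ χ ∧ HasCompactSupport χ ∧ (∀ p ∈ S, χ p = 1) ∧
      ∀ (η : ℂ → V →L[ℝ] F) (_ : IsBForm n η) (h : IsBForm n (χ • η)),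
        integralB (χ • η) h J = 0 := by
  refine hS.induction_on (p := fun S => ∃ χ : ℂ → ℝ, ContDiff ℝ ∞ χ ∧ HasCompactSupport χ ∧
    (∀ p ∈ S, χ p = 1) ∧ ∀ (η : ℂ → V →L[ℝ] F) (_ : IsBForm n η) (h : IsBForm n (χ • η)),
      integralB (χ • η) h J = 0) ?_ ?_ ?_ ?_
  · refine ⟨0, contDiff_const, HasCompactSupport.zero, by simp, fun η hη h => ?_⟩
    exact integralB_eq_of_tendsto _ (exists_tendsto_ofPointed J).choose_spec
      (by simp [evalForm, Finsupp.sum])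
  · rintro S T hST ⟨χ, h1, h2, h3, h4⟩
    exact ⟨χ, h1, h2, fun p hp => h3 p (hST hp), h4⟩
  · rintro S T ⟨χ, h1, h2, h3, h4⟩ ⟨ψ, k1, k2, k3, k4⟩
    have hd : ContDiff ℝ ∞ ((1 - χ) * ψ) := (contDiff_const.sub h1).mul k1
    have hds : HasCompactSupport ((1 - χ) * ψ) := k2.mul_left
    -- This is 1 - (1 - χ)(1 - ψ), which is 1 wherever χ or ψ is. The form regroups as χ • (η - ψ •
    -- η) + ψ • η, which is why the annihilation property must hold for every η.
    refine ⟨χ + (1 - χ) * ψ, h1.add hd, h2.add hds, ?_, fun η hη h => ?_⟩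
    · rintro p (hp | hp)
      · simp [h3 p hp]
      · simp [k3 p hp]
    · have e : (χ + (1 - χ) * ψ) • η = χ • (η + (-1 : ℝ) • ψ • η) + ψ • η := by
        funext p
        simp only [Pi.smul_apply', Pi.add_apply, Pi.mul_apply, Pi.sub_apply, Pi.one_apply,
          Pi.smul_apply]
        module
      have hψ : IsBForm n (ψ • η) := hη.smul k1 k2
      have hψ' : IsBForm n ((-1 : ℝ) • ψ • η) := by
        have : (-1 : ℝ) • ψ • η = (-ψ) • η := by
          funext p
          simp
        rw [this]
        exact hη.smul k1.neg k2.neg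
      have hχ : IsBForm n (χ • (η + (-1 : ℝ) • ψ • η)) := (hη.add hψ').smul h1 h2
      rw [integralB_congr e h (hχ.add hψ), integralB_add hχ hψ, h4 _ (hη.add hψ'), k4 _ hη,
        add_zero]
  · intro p hp
    have hp' : p ∉ supp J := hd hp
    simp only [supp, Set.mem_sInter, Set.mem_ofPred_eq, not_forall] at hp'
    obtain ⟨X, ⟨hXc, hX⟩, hpX⟩ := hp'
    -- A point off supp J is missed by some closed supporting set X; a bump on a small ball off X
    -- then annihilates `J`.
    obtain ⟨ε, hε, hball⟩ := Metric.isOpen_iff.1 hXc.isOpen_compl p hpX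
    obtain ⟨χ, h1, h2, h3, h4⟩ := exists_cutoff (K := Metric.closedBall p (ε / 2))
      (U := Metric.ball p ε) (isCompact_closedBall _ _) Metric.isOpen_ball
      (Metric.closedBall_subset_ball (by linarith))
    refine ⟨Metric.closedBall p (ε / 2),
      mem_nhdsWithin_of_mem_nhds (Metric.closedBall_mem_nhds _ (by linarith)), χ, h1, h2,
      fun q hq => h4.self_of_nhdsSet q hq, fun η hη h => ?_⟩
    -- `Supports` tests only non-empty open sets, which matters if X is empty; the plane is not
    -- compact, so this complement is non-empty.
    refine hX.integralB_eq_zero (W := (tsupport χ)ᶜ) (isClosed_tsupport χ).isOpen_compl ?_ ?_ h ?_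
    · by_contra hne
      rw [Set.not_nonempty_iff_eq_empty, Set.compl_empty_iff] at hne
      have hc := h2.isCompact
      rw [hne] at hc
      exact noncompact_univ ℂ hc
    · exact fun x hx hxs => hball (h3 hxs) hx
    · intro q hq
      simp [image_eq_zero_of_notMem_tsupport hq]

theorem isClosed_supp {n : ℕ} (J : Chain ℂ V n) : IsClosed (supp J) :=
  isClosed_sInter fun _ hX => hX.1

/-- The product χ • η is non-zero only on a compact set off the support, where an annihilating
cutoff φ equals 1; multiplying by φ therefore changes nothing. -/
theorem integralB_eq_zero_of_compact {n : ℕ} (J : Chain ℂ V n) {χ : ℂ → ℝ}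
    (hc : HasCompactSupport χ) {η : ℂ → V →L[ℝ] F}
    (h : ∀ᶠ p in 𝓝ˢ (supp J), η p = 0) (hχη : IsBForm n (χ • η)) :
    integralB (χ • η) hχη J = 0 := by
  obtain ⟨O, hO, hJO, hη0⟩ := eventually_nhdsSet_iff_exists.1 h
  obtain ⟨φ, h1, h2, h3, h4⟩ := exists_annihilating_cutoff J (S := tsupport χ \ O)
    (hc.isCompact.diff hO) (fun p hp hpJ => hp.2 (hJO hpJ)) F
  have e : χ • η = φ • (χ • η) := by
    funext p
    simp only [Pi.smul_apply']
    by_cases hpO : p ∈ O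
    · simp [hη0 p hpO]
    · by_cases hp : p ∈ tsupport χ
      · simp [h3 p ⟨hp, hpO⟩]
      · simp [image_eq_zero_of_notMem_tsupport hp]
  rw [integralB_congr e hχη (hχη.smul h1 h2)]
  exact h4 _ hχη _

/-- The integral over `J` of a form that vanishes near the support of `J` is zero. -/
theorem integralB_eq_zero {n : ℕ} (J : Chain ℂ V n) {η : ℂ → V →L[ℝ] F} (hη : IsBForm n η)
    (h : ∀ᶠ p in 𝓝ˢ (supp J), η p = 0) : integralB η hη J = 0 := by
  obtain ⟨χ, h1, h2, -, h4⟩ := exists_cutoff (K := Metric.closedBall (0 : ℂ) 1)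
    (isCompact_closedBall _ _) isOpen_univ (Set.subset_univ _)
  obtain ⟨C, hC, hb⟩ := exists_diffBound h1 h2 n
  obtain ⟨D, hD, hη'⟩ := hη.exists_diffBound
  obtain ⟨A, hA⟩ := exists_tendsto_ofPointed J
  have key : ∀ i, ‖integralB η hη J‖ ≤ (D + 2 ^ n * (C * D)) * ‖J - ofPointed n (A i)‖ := by
    intro i
    -- The radius depends on i, but R ≥ 1 makes the dilated cutoff ψ obey the same difference bound
    -- as χ, uniformly in i.
    obtain ⟨R, hR1, hR⟩ : ∃ R : ℝ, 1 ≤ R ∧ ∀ p ∈ (A i).support, ‖p‖ ≤ R := by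
      obtain ⟨R, hR⟩ := (A i).support.finite_toSet.isBounded.exists_norm_le
      exact ⟨max R 1, le_max_right _ _, fun p hp => (hR p hp).trans (le_max_left _ _)⟩
    have hR0 : 0 < R := by linarith
    let ψ : ℂ → ℝ := fun p => χ (R⁻¹ • p)
    have hψ : ContDiff ℝ ∞ ψ := h1.comp (contDiff_const_smul _)
    have hψc : HasCompactSupport ψ := h2.comp_smul (inv_ne_zero hR0.ne')
    have hψb : DiffBound n C ψ := by
      have := hb.comp_affine hC (DistribSMul.toAddMonoidHom ℂ R⁻¹) (fun u => ?_) 0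
      · simp only [add_zero] at this
        exact this
      · rw [DistribSMul.toAddMonoidHom_apply, norm_smul, Real.norm_eq_abs, abs_inv, abs_of_pos hR0]
        exact mul_le_of_le_one_left (norm_nonneg _) (inv_le_one_of_one_le₀ hR1)
    have hψη : DiffBound n (2 ^ n * (C * D)) (ψ • η) := hψb.smul hη'
    have hB : IsBForm n (ψ • η) := hψη.isBForm (by positivity)
    have e1 := integralB_eq_zero_of_compact J hψc h hB
    have e2 : evalForm η (A i) = evalForm (ψ • η) (A i) := by
      refine evalForm_congr fun p hp => ?_
      have : χ (R⁻¹ • p) = 1 := by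
        refine h4.self_of_nhdsSet _ ?_
        rw [mem_closedBall_zero_iff, norm_smul, norm_inv, Real.norm_eq_abs, abs_of_pos hR0,
          inv_mul_le_iff₀ hR0, mul_one]
        exact hR p hp
      rw [Pi.smul_apply', show ψ p = 1 from this, one_smul]
    -- The forms η and ψ • η agree on the pointed chain, and `J` annihilates ψ • η; only the error
    -- `J - ofPointed n (A i)` remains to be integrated.
    have e3 : integralB η hη J = integralB η hη (J - ofPointed n (A i)) -
        integralB (ψ • η) hB (J - ofPointed n (A i)) := by
      simp only [map_sub, integralB_ofPointed, e1, e2]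
      abel
    rw [e3, add_mul]
    exact (norm_sub_le _ _).trans (add_le_add (norm_integralB_le hD hη' hη _)
      (norm_integralB_le (by positivity) hψη hB _))
  have hlim : Tendsto (fun i => (D + 2 ^ n * (C * D)) * ‖J - ofPointed n (A i)‖) atTop (𝓝 0) := by
    have := ((tendsto_const_nhds (x := J)).sub hA).norm.const_mul (D + 2 ^ n * (C * D))
    simpa using this
  exact norm_le_zero_iff.1 (ge_of_tendsto' hlim key)

theorem IsBForm.neg {n : ℕ} {η : ℂ → V →L[ℝ] F} (hη : IsBForm n η) : IsBForm n (-η) := by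
  obtain ⟨C, hC, h⟩ := hη.exists_diffBound
  have := h.comp_clm (-ContinuousLinearMap.id ℝ (V →L[ℝ] F))
  exact DiffBound.isBForm (by positivity) this

/-- The integral of a `B`-form over `J` depends only on the form near the support of `J`. -/
theorem integralB_eq_of_eventuallyEq {n : ℕ} (J : Chain ℂ V n) {η η' : ℂ → V →L[ℝ] F}
    (hη : IsBForm n η) (hη' : IsBForm n η') (h : ∀ᶠ p in 𝓝ˢ (supp J), η p = η' p) :
    integralB η hη J = integralB η' hη' J := by
  have hs : IsBForm n (η + -η') := hη.add hη'.neg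
  have h0 := integralB_eq_zero J hs (h.mono fun p hp => by simp [hp])
  have e : η = (η + -η') + η' := by simp
  rw [integralB_congr e hη (hs.add hη'), integralB_add hs hη', h0, zero_add]

/-- By locality the extension picked in the definition is immaterial, since any two agree near the
support. -/
theorem integral_eq_integralB {n : ℕ} {J : Chain ℂ V n} {ζ η : ℂ → V →L[ℝ] F}
    (h : IsExtension J ζ η) : integral J ζ = integralB η h.1 J := by
  have hi : Integrable J ζ := ⟨η, h⟩
  rw [integral, dif_pos hi]
  refine integralB_eq_of_eventuallyEq J _ _ ?_
  filter_upwards [hi.choose_spec.2, h.2] with p h1 h2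
  rw [h1, h2]

end Locality

/-! ### Exact forms -/

section Exact

theorem isBForm_formDz {f : ℂ → ℂ} (hf : ContDiff ℝ ∞ f) (hc : HasCompactSupport f)
    (n : ℕ) : IsBForm n (formDz f) := by
  obtain ⟨C, hC, h⟩ := exists_diffBound hf hc n
  exact DiffBound.isBForm (by positivity)
    (h.comp_clm ((ContinuousLinearMap.toSpanSingleton ℂ
      (ContinuousLinearMap.id ℝ ℂ)).restrictScalars ℝ))

/-- The function `g`, regarded as a form of degree `0`. -/
def zeroForm (g : ℂ → ℂ) : ℂ → ℝ →L[ℝ] ℂ :=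
  fun p => ContinuousLinearMap.toSpanSingleton ℝ (g p)

theorem isBForm_zeroForm {g : ℂ → ℂ} (hg : ContDiff ℝ ∞ g) (hc : HasCompactSupport g)
    (n : ℕ) : IsBForm n (zeroForm g) := by
  obtain ⟨C, hC, h⟩ := exists_diffBound hg hc n
  exact DiffBound.isBForm (by positivity)
    (h.comp_clm (ContinuousLinearMap.toSpanSingletonCLE (𝕜 := ℝ) (E := ℂ) : ℂ →L[ℝ] ℝ →L[ℝ] ℂ))

theorem isBForm_fderiv {g : ℂ → ℂ} (hg : ContDiff ℝ ∞ g) (hc : HasCompactSupport g)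
    (n : ℕ) : IsBForm n (fderiv ℝ g) := by
  obtain ⟨C, hC, h⟩ := exists_diffBound (hg.fderiv_right (m := ∞) (by simp)) (hc.fderiv ℝ) n
  exact h.isBForm hC

/-- Integration is continuous, so it passes through the limit defining the prederivative and leaves
the difference quotients of g in direction v. -/
theorem integralB_prederiv_single {s t : ℕ} (h : s < t) (ht : 2 ≤ t) {g : ℂ → ℂ}
    (hg : Differentiable ℝ g) (hB : IsBForm t (zeroForm g)) (v p : ℂ) (a : ℝ) :
    integralB (zeroForm g) hB (prederiv h ht v (ofPointed s (Finsupp.single p a))) =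
      a • fderiv ℝ g p v := by
  have e : prederiv h ht v (ofPointed s (Finsupp.single p a)) =
      prederivPointed t v (Finsupp.single p a) := extendChain_ofPointed s _ _ _
  rw [e]
  refine tendsto_nhds_unique (((integralB (zeroForm g) hB).continuous.tendsto _).comp
    (tendsto_prederivPointed ht v (Finsupp.single p a))) ?_
  have hd := (hg p).hasFDerivAt.hasLineDerivAt v
  have := (hasDerivAt_iff_tendsto_slope_zero.1 hd).const_smul a
  refine this.congr fun x => ?_
  simp only [Function.comp, integralB_ofPointed, map_smul, evalForm_diff, evalForm_single]
  simp only [fwdDiff, zeroForm, sub_apply,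
    ContinuousLinearMap.toSpanSingleton_apply, zero_add, zero_smul, add_zero]
  module

theorem mapCoeff_single {V W : Type*} [NormedAddCommGroup V] [NormedSpace ℝ V]
    [NormedAddCommGroup W] [NormedSpace ℝ W] (r : ℕ) (T : V →L[ℝ] W) (p : ℂ) (α : V) :
    mapCoeff r T (ofPointed r (Finsupp.single p α)) = ofPointed r (Finsupp.single p (T α)) := by
  rw [mapCoeff, extendChain_ofPointed]
  simp

/-- Stokes' theorem for `1`-chains. -/
theorem integralB_boundary₁ {s t : ℕ} (h : s < t) (ht : 2 ≤ t) {g : ℂ → ℂ}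
    (hg : ContDiff ℝ ∞ g) (hB : IsBForm t (zeroForm g)) (hD : IsBForm s (fderiv ℝ g))
    (J : Chain ℂ ℂ s) :
    integralB (zeroForm g) hB (boundary₁ h ht J) = integralB (fderiv ℝ g) hD J := by
  induction J using chain_induction with
  | hP =>
    exact isClosed_eq ((integralB _ hB).continuous.comp (boundary₁ h ht).continuous)
      (integralB _ hD).continuous
  | h A =>
    induction A using Finsupp.induction_linear with
    | zero => simp
    | add f g hf hg => simp only [map_add, hf, hg]
    | single p α =>
      have hg' : Differentiable ℝ g := hg.differentiable (by simp)
      simp only [boundary₁, retract₁, add_apply,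
        ContinuousLinearMap.comp_apply, mapCoeff_single, map_add,
        integralB_prederiv_single h ht hg' hB, integralB_ofPointed, evalForm_single]
      -- Inside the derivative the two terms reassemble α from its coordinates along 1 and I.
      rw [← map_smul, ← map_smul, ← map_add]
      congr 1
      apply Complex.ext <;> simp [Complex.inner]

theorem integralB_fderiv_eq_zero {s t : ℕ} (h : s < t) (ht : 2 ≤ t) {J : Chain ℂ ℂ s}
    (hJ : boundary₁ h ht J = 0) {g : ℂ → ℂ} (hg : ContDiff ℝ ∞ g) (hc : HasCompactSupport g)
    (hD : IsBForm s (fderiv ℝ g)) : integralB (fderiv ℝ g) hD J = 0 := by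
  rw [← integralB_boundary₁ h ht hg (isBForm_zeroForm hg hc t), hJ, map_zero]

end Exact

/-! ### The Cauchy-Pompeiu formula -/

section Pompeiu

open MeasureTheory Set

/-- The Wirtinger derivative `∂f/∂z̄`. -/
def dbar (f : ℂ → ℂ) (z : ℂ) : ℂ :=
  (fderiv ℝ f z 1 + Complex.I * fderiv ℝ f z Complex.I) / 2

/-- The unit vector in direction `θ`. -/
def expI (θ : ℝ) : ℂ := Complex.exp (θ * Complex.I)

theorem norm_expI (θ : ℝ) : ‖expI θ‖ = 1 := Complex.norm_exp_ofReal_mul_I θ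

theorem hasDerivAt_expI (θ : ℝ) : HasDerivAt expI (Complex.I * expI θ) θ := by
  have h : HasDerivAt (fun θ : ℝ => (θ : ℂ) * Complex.I) (1 * Complex.I) θ :=
    (Complex.ofRealCLM.hasDerivAt (x := θ)).mul_const _
  have := h.cexp
  rwa [one_mul, mul_comm] at this

theorem continuous_expI : Continuous expI := by
  unfold expI
  fun_prop

theorem fderiv_apply_eq (T : ℂ →L[ℝ] ℂ) (v : ℂ) : T v = v.re * T 1 + v.im * T Complex.I := by
  have : v = v.re • (1 : ℂ) + v.im • Complex.I := by
    apply Complex.ext <;> simp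
  conv_lhs => rw [this, map_add, map_smul, map_smul]
  simp

/-- The Wirtinger derivative in polar coordinates. -/
theorem polar_dbar (f : ℂ → ℂ) (z : ℂ) (ρ θ : ℝ) (hρ : 0 < ρ) :
    ρ * (dbar f z / (ρ * expI θ)) = 2⁻¹ * (fderiv ℝ f z (expI θ) +
      Complex.I * ((ρ : ℂ)⁻¹ * fderiv ℝ f z (ρ * (Complex.I * expI θ)))) := by
  have hρ' : (ρ : ℂ) ≠ 0 := by exact_mod_cast hρ.ne'
  have h1 : fderiv ℝ f z (ρ * (Complex.I * expI θ)) =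
      ρ * fderiv ℝ f z (Complex.I * expI θ) := by
    have := (fderiv ℝ f z).map_smul ρ (Complex.I * expI θ)
    simpa using this
  have hne : expI θ ≠ 0 := Complex.exp_ne_zero _
  rw [h1, fderiv_apply_eq _ (expI θ), fderiv_apply_eq _ (Complex.I * expI θ), dbar]
  have hc : expI θ = Real.cos θ + Real.sin θ * Complex.I := by
    simp [expI, Complex.exp_mul_I]
  have hre : (expI θ).re = Real.cos θ := Complex.exp_ofReal_mul_I_re θ
  have him : (expI θ).im = Real.sin θ := Complex.exp_ofReal_mul_I_im θ
  have hre' : (Complex.I * expI θ).re = -Real.sin θ := by simp [him]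
  have him' : (Complex.I * expI θ).im = Real.cos θ := by simp [hre]
  rw [hre, him, hre', him', Complex.ofReal_neg, inv_mul_cancel_left₀ hρ']
  have hsc : (Real.cos θ : ℂ) ^ 2 + (Real.sin θ : ℂ) ^ 2 = 1 := by
    exact_mod_cast Real.cos_sq_add_sin_sq θ
  have hI := Complex.I_sq
  generalize (Real.cos θ : ℂ) = c at *
  generalize (Real.sin θ : ℂ) = s at *
  -- The identity to be proved is e^{-iθ}(∂_x + i∂_y) = ∂_ρ + (i/ρ)∂_θ.
  have hinv : (expI θ)⁻¹ = c - Complex.I * s := by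
    refine inv_eq_of_mul_eq_one_right ?_
    rw [hc]
    linear_combination hsc - s ^ 2 * hI
  generalize fderiv ℝ f z 1 = a
  generalize fderiv ℝ f z Complex.I = b
  have e : ρ * ((a + Complex.I * b) / 2 / (ρ * expI θ)) =
      2⁻¹ * ((a + Complex.I * b) * (expI θ)⁻¹) := by
    field_simp
  rw [e, hinv]
  linear_combination (-(2⁻¹ * b * s)) * hI

variable {f : ℂ → ℂ}

/-- The radial range is infinite, but the function lives on 0 < ρ ≤ R, a rectangle of finite measure
on which it is bounded. -/
theorem integrableOn_polar {g : ℝ × ℝ → ℂ} {C R : ℝ}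
    (hg : ContinuousOn g (Ioi 0 ×ˢ Ioo (-Real.pi) Real.pi))
    (hC : ∀ p ∈ Ioi (0 : ℝ) ×ˢ Ioo (-Real.pi) Real.pi, ‖g p‖ ≤ C)
    (hR : ∀ p ∈ Ioi (0 : ℝ) ×ˢ Ioo (-Real.pi) Real.pi, R < p.1 → g p = 0) :
    IntegrableOn g (Ioi 0 ×ˢ Ioo (-Real.pi) Real.pi) := by
  have hm : MeasurableSet (Ioi (0 : ℝ) ×ˢ Ioo (-Real.pi) Real.pi) :=
    measurableSet_Ioi.prod measurableSet_Ioo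
  have h1 : IntegrableOn g (Ioc 0 R ×ˢ Ioo (-Real.pi) Real.pi) := by
    refine IntegrableOn.of_bound (C := C) ?_ ?_ ?_
    · rw [Measure.volume_eq_prod, Measure.prod_prod]
      exact ENNReal.mul_lt_top (by simp) (by simp)
    · exact (hg.mono (prod_mono Ioc_subset_Ioi_self Subset.rfl)).aestronglyMeasurable
        (measurableSet_Ioc.prod measurableSet_Ioo)
    · refine (ae_restrict_iff' (measurableSet_Ioc.prod measurableSet_Ioo)).2 (ae_of_all _ ?_)
      exact fun p hp => hC p ⟨hp.1.1, hp.2⟩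
  refine h1.of_forall_sdiff_eq_zero hm ?_
  rintro p ⟨hp, hp'⟩
  refine hR p hp (not_le.1 fun h => hp' ⟨⟨hp.1, h⟩, hp.2⟩)

/-- The Cauchy-Pompeiu formula for functions of compact support. -/
theorem integral_dbar_div (hf : ContDiff ℝ ∞ f) (hc : HasCompactSupport f) (w : ℂ) :
    ∫ z, dbar f z / (z - w) = -Real.pi * f w := by
  have hd : Differentiable ℝ f := hf.differentiable (by simp)
  have hcd : Continuous (fderiv ℝ f) := hf.continuous_fderiv (by simp)
  obtain ⟨C, hC⟩ := (hc.fderiv ℝ).exists_bound_of_continuous hcd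
  obtain ⟨R, hR⟩ := hc.isCompact.isBounded.subset_closedBall w
  have hR0 : ∀ ρ θ : ℝ, R < ρ → 0 < ρ → w + ρ * expI θ ∉ tsupport f := by
    intro ρ θ h h0 hmem
    have := hR hmem
    rw [Metric.mem_closedBall, dist_eq_norm, add_sub_cancel_left, norm_mul, norm_expI, mul_one,
      Complex.norm_real, Real.norm_eq_abs, abs_of_pos h0] at this
    linarith
  have hRd : ∀ ρ θ : ℝ, R < ρ → 0 < ρ → fderiv ℝ f (w + ρ * expI θ) = 0 := fun ρ θ h h0 =>
    image_eq_zero_of_notMem_tsupport fun hm => hR0 ρ θ h h0 (tsupport_fderiv_subset ℝ hm)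
  let S : Set (ℝ × ℝ) := Ioi 0 ×ˢ Ioo (-Real.pi) Real.pi
  -- For f(w + ρe^{iθ}), g₁ is ∂_ρ and g₂ is ρ⁻¹∂_θ.
  let g₁ : ℝ × ℝ → ℂ := fun p => fderiv ℝ f (w + p.1 * expI p.2) (expI p.2)
  let g₂ : ℝ × ℝ → ℂ := fun p =>
    (p.1 : ℂ)⁻¹ * fderiv ℝ f (w + p.1 * expI p.2) (p.1 * (Complex.I * expI p.2))
  have hce := continuous_expI
  have hb : Continuous fun p : ℝ × ℝ => fderiv ℝ f (w + p.1 * expI p.2) :=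
    hcd.comp (by fun_prop)
  have hg₁ : IntegrableOn g₁ S := by
    refine integrableOn_polar (C := C) (R := R) ?_ ?_ ?_
    · exact (hb.clm_apply (by fun_prop)).continuousOn
    · intro p _
      refine ((fderiv ℝ f _).le_opNorm _).trans ?_
      rw [norm_expI, mul_one]
      exact hC _
    · intro p hp h
      simp [g₁, hRd _ _ h hp.1]
  have hg₂ : IntegrableOn g₂ S := by
    refine integrableOn_polar (C := C) (R := R) ?_ ?_ ?_
    · refine ContinuousOn.mul ?_ (hb.clm_apply (by fun_prop)).continuousOn
      refine ContinuousOn.inv₀ (by fun_prop) fun p hp => ?_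
      exact_mod_cast (show (0 : ℝ) < p.1 from hp.1).ne'
    · intro p hp
      have hp1 : (0 : ℝ) < p.1 := hp.1
      have := (fderiv ℝ f (w + p.1 * expI p.2)).le_opNorm (p.1 * (Complex.I * expI p.2))
      simp only [norm_mul, Complex.norm_real, Complex.norm_I, norm_expI, mul_one] at this
      simp only [g₂, norm_mul, norm_inv, Complex.norm_real]
      rw [inv_mul_le_iff₀ (by simpa using hp1.ne')]
      refine this.trans (le_of_le_of_eq ?_ (mul_comm _ _))
      exact (mul_le_mul_of_nonneg_right (hC _) (norm_nonneg _))
    · intro p hp h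
      simp [g₂, hRd _ _ h hp.1]
  -- Each ray runs from w to where f vanishes, so the fundamental theorem of calculus leaves the
  -- value at w with a minus sign.
  have hline : ∀ θ : ℝ, ∫ ρ in Ioi (0 : ℝ), g₁ (ρ, θ) = - f w := by
    intro θ
    have hder : ∀ ρ ∈ Ici (0 : ℝ), HasDerivAt (fun ρ : ℝ => f (w + ρ * expI θ)) (g₁ (ρ, θ)) ρ := by
      intro ρ _
      have h1 : HasDerivAt (fun ρ : ℝ => w + (ρ : ℂ) * expI θ) (expI θ) ρ := by
        simpa using ((Complex.ofRealCLM.hasDerivAt (x := ρ)).mul_const (expI θ)).const_add w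
      exact (hd _).hasFDerivAt.comp_hasDerivAt ρ h1
    have hi : IntegrableOn (fun ρ => g₁ (ρ, θ)) (Ioi 0) := by
      have hi' : MeasureTheory.Integrable (fun ρ : ℝ => g₁ (ρ, θ)) (volume.restrict (Ioc 0 R)) :=
        Continuous.integrableOn_Ioc <| ((hcd.comp (by fun_prop)).clm_apply continuous_const :
          Continuous fun ρ : ℝ => fderiv ℝ f (w + ρ * expI θ) (expI θ))
      refine IntegrableOn.of_forall_sdiff_eq_zero hi' measurableSet_Ioi ?_
      rintro ρ ⟨h0, h1⟩
      have : R < ρ := not_le.1 fun h => h1 ⟨h0, h⟩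
      simp [g₁, hRd _ _ this h0]
    have hlim : Tendsto (fun ρ : ℝ => f (w + ρ * expI θ)) atTop (𝓝 0) := by
      refine tendsto_const_nhds.congr' ?_
      filter_upwards [eventually_gt_atTop R, eventually_gt_atTop 0] with ρ h h0
      exact (image_eq_zero_of_notMem_tsupport (hR0 ρ θ h h0)).symm
    have := integral_Ioi_of_hasDerivAt_of_tendsto' hder hi hlim
    simpa using this
  -- On a full circle f returns to its initial value.
  have hcirc : ∀ ρ : ℝ, ∫ θ in Ioo (-Real.pi) Real.pi, g₂ (ρ, θ) = 0 := by
    intro ρ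
    simp only [g₂, integral_const_mul]
    rw [← integral_Ioc_eq_integral_Ioo, ← intervalIntegral.integral_of_le (by linarith [Real.pi_pos])]
    have hder : ∀ θ ∈ uIcc (-Real.pi) Real.pi, HasDerivAt (fun θ : ℝ => f (w + ρ * expI θ))
        (fderiv ℝ f (w + ρ * expI θ) (ρ * (Complex.I * expI θ))) θ := by
      intro θ _
      exact (hd _).hasFDerivAt.comp_hasDerivAt θ (((hasDerivAt_expI θ).const_mul _).const_add w)
    rw [intervalIntegral.integral_eq_sub_of_hasDerivAt hder]
    · simp [expI, Complex.exp_neg, Complex.exp_pi_mul_I]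
    · refine Continuous.intervalIntegrable ?_ _ _
      exact (hcd.comp (by fun_prop)).clm_apply (by fun_prop)
  have hshift : ∫ z, dbar f z / (z - w) = ∫ z, dbar f (w + z) / z := by
    rw [← integral_add_left_eq_self _ w]
    simp
  rw [hshift, ← Complex.integral_comp_polarCoord_symm, polarCoord_target]
  -- The polar Jacobian ρ cancels the pole of the kernel.
  have hpt : ∀ p ∈ S, p.1 • (dbar f (w + Complex.polarCoord.symm p) / Complex.polarCoord.symm p) =
      2⁻¹ * (g₁ p + Complex.I * g₂ p) := by
    intro p hp
    have e : Complex.polarCoord.symm p = p.1 * expI p.2 := by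
      rw [Complex.polarCoord_symm_apply]
      simp [expI, Complex.exp_mul_I]
    rw [e, Complex.real_smul]
    exact polar_dbar f _ p.1 p.2 hp.1
  rw [setIntegral_congr_fun (measurableSet_Ioi.prod measurableSet_Ioo) hpt, integral_const_mul,
    integral_add hg₁ (hg₂.const_mul _), integral_const_mul]
  have e2 : ∫ p in S, g₂ p = 0 := by
    rw [Measure.volume_eq_prod] at hg₂ ⊢
    rw [setIntegral_prod _ hg₂]
    simp [hcirc]
  have e1 : ∫ p in S, g₁ p = -(2 * Real.pi) * f w := by
    rw [Measure.volume_eq_prod] at hg₁ ⊢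
    rw [← Measure.prod_restrict, integral_prod_symm _ (by rwa [Measure.prod_restrict])]
    simp only [hline]
    rw [setIntegral_const, Real.volume_real_Ioo_of_le (by linarith [Real.pi_pos])]
    rw [Complex.real_smul]
    push_cast
    ring
  rw [e1, e2]
  ring

end Pompeiu

/-! ### Holomorphic forms and the index -/

section Holomorphic

/-- No control of h off O is needed: near a point outside the support of χ the product is zero, and
on O holomorphy gives smoothness. -/
theorem contDiff_cutoff_smul {χ : ℂ → ℝ} {h : ℂ → ℂ} {O : Set ℂ} (hχ : ContDiff ℝ ∞ χ)
    (hO : IsOpen O) (hs : tsupport χ ⊆ O) (hh : DifferentiableOn ℂ h O) :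
    ContDiff ℝ ∞ (χ • h) := by
  rw [contDiff_iff_contDiffAt]
  intro p
  by_cases hp : p ∈ tsupport χ
  · have : ContDiffAt ℂ ∞ h p := (hh.contDiffOn hO).contDiffAt (hO.mem_nhds (hs hp))
    exact hχ.contDiffAt.smul (this.restrict_scalars ℝ)
  · have : χ • h =ᶠ[𝓝 p] fun _ => 0 := by
      filter_upwards [notMem_tsupport_iff_eventuallyEq.1 hp] with q hq
      simp [hq]
    exact contDiffAt_const.congr_of_eventuallyEq this

theorem isExtension_formDz {n : ℕ} {J : Chain ℂ ℂ n} {χ : ℂ → ℝ} {h : ℂ → ℂ} {O : Set ℂ}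
    (hχ : ContDiff ℝ ∞ χ) (hc : HasCompactSupport χ) (hO : IsOpen O) (hs : tsupport χ ⊆ O)
    (h1 : ∀ᶠ p in 𝓝ˢ (supp J), χ p = 1) (hh : DifferentiableOn ℂ h O) :
    IsExtension J (formDz h) (formDz (χ • h)) := by
  refine ⟨isBForm_formDz (contDiff_cutoff_smul hχ hO hs hh) hc.smul_right n, ?_⟩
  filter_upwards [h1] with p hp
  simp [formDz, hp]

/-- The integral is built as an ℝ-linear map on chains, so complex constants are pulled out on
pointed chains and the identity extends by density. -/
theorem integralB_formDz_const_mul {n : ℕ} {h : ℂ → ℂ} (c : ℂ) (hB : IsBForm n (formDz h))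
    (hcB : IsBForm n (formDz fun w => c * h w)) (J : Chain ℂ ℂ n) :
    integralB (formDz fun w => c * h w) hcB J = c * integralB (formDz h) hB J := by
  induction J using chain_induction with
  | hP =>
    exact isClosed_eq (integralB _ hcB).continuous
      (continuous_const.mul (integralB _ hB).continuous)
  | h A =>
    rw [integralB_ofPointed, integralB_ofPointed]
    induction A using Finsupp.induction_linear with
    | zero => simp
    | add f g hf hg => simp only [map_add, hf, hg, mul_add]
    | single p α => simp [evalForm_single, formDz, mul_assoc]

/-- The integral of a differential `h' dz` over a closed chain vanishes. -/
theorem integral_deriv_eq_zero {s t : ℕ} (hst : s < t) (ht : 2 ≤ t) {J : Chain ℂ ℂ s}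
    (hJ : boundary₁ hst ht J = 0) (hJc : IsCompact (supp J)) {h h' : ℂ → ℂ} {O : Set ℂ}
    (hO : IsOpen O) (hJO : supp J ⊆ O) (hh : ∀ w ∈ O, HasDerivAt h (h' w) w)
    {η : ℂ → ℂ →L[ℝ] ℂ} (hη : IsBForm s η) (he : ∀ᶠ p in 𝓝ˢ (supp J), η p = formDz h' p) :
    integralB η hη J = 0 := by
  obtain ⟨χ, h1, h2, h3, h4⟩ := exists_cutoff hJc hO hJO
  have hsm : ContDiff ℝ ∞ (χ • h) := contDiff_cutoff_smul h1 hO h3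
    fun w hw => (hh w hw).differentiableAt.differentiableWithinAt
  have hsc : HasCompactSupport (χ • h) := h2.smul_right
  have hD := isBForm_fderiv hsm hsc s
  rw [← integralB_fderiv_eq_zero hst ht hJ hsm hsc hD]
  refine integralB_eq_of_eventuallyEq J _ _ ?_
  obtain ⟨O', hO', hJO', hχ⟩ := eventually_nhdsSet_iff_exists.1 h4
  filter_upwards [he, (hO.inter hO').mem_nhdsSet.2 (Set.subset_inter hJO hJO')] with p hp hpO
  rw [hp]
  have hev : χ • h =ᶠ[𝓝 p] h := by
    filter_upwards [hO'.mem_nhds hpO.2] with q hq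
    simp [hχ q hq]
  rw [hev.fderiv_eq, ((hh p hpO.1).hasFDerivAt.restrictScalars ℝ).fderiv]
  ext
  simp [formDz, mul_comm]

/-- The Cauchy integral of the constant function, `∫_J dw / (w - z)`. -/
def cauchyIntegral {n : ℕ} (J : Chain ℂ ℂ n) (z : ℂ) : ℂ :=
  integral J (formDz fun w => (w - z)⁻¹)

theorem differentiableOn_inv_sub {O : Set ℂ} {z : ℂ} (hz : z ∉ O) :
    DifferentiableOn ℂ (fun w => (w - z)⁻¹) O := by
  refine DifferentiableOn.fun_inv (by fun_prop) fun w hw h => ?_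
  rw [sub_eq_zero] at h
  exact hz (h ▸ hw)

/-- The ratio (w - z)/(w - z₀) lies within distance 1 of 1, so the principal logarithm is
holomorphic there; its derivative is the difference of the two Cauchy kernels. -/
theorem hasDerivAt_log_ratio {z z₀ w : ℂ} (h : ‖z - z₀‖ < ‖w - z₀‖) :
    HasDerivAt (fun w => Complex.log (1 + -(z - z₀) * (w - z₀)⁻¹))
      ((w - z)⁻¹ - (w - z₀)⁻¹) w := by
  have hw0 : w - z₀ ≠ 0 := by
    intro h0
    rw [h0, norm_zero] at h
    exact absurd h (norm_nonneg _).not_gt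
  have hw : w - z ≠ 0 := by
    intro h0
    rw [sub_eq_zero] at h0
    rw [h0] at h
    exact lt_irrefl _ h
  have hs : 1 + -(z - z₀) * (w - z₀)⁻¹ ∈ Complex.slitPlane := by
    refine Complex.mem_slitPlane_of_norm_lt_one ?_
    rw [norm_mul, norm_neg, norm_inv, ← div_eq_mul_inv, div_lt_one (norm_pos_iff.2 hw0)]
    exact h
  have e : 1 + -(z - z₀) * (w - z₀)⁻¹ = (w - z) * (w - z₀)⁻¹ := by
    field_simp
    ring
  have h1 : HasDerivAt (fun w : ℂ => w - z₀) 1 w := (hasDerivAt_id w).sub_const z₀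
  have h2 := ((h1.fun_inv hw0).const_mul (-(z - z₀))).const_add 1
  convert h2.clog hs using 1
  rw [e]
  field_simp
  ring

/-- The index of a closed chain is locally constant off the support. -/
theorem eventually_cauchyIntegral_eq {s t : ℕ} (hst : s < t) (ht : 2 ≤ t) {J : Chain ℂ ℂ s}
    (hJ : boundary₁ hst ht J = 0) (hJc : IsCompact (supp J)) {z₀ : ℂ} (hz₀ : z₀ ∉ supp J) :
    ∀ᶠ z in 𝓝 z₀, cauchyIntegral J z = cauchyIntegral J z₀ := by
  obtain ⟨ε, hε, hball⟩ := Metric.nhds_basis_closedBall.mem_iff.1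
    ((isClosed_supp J).isOpen_compl.mem_nhds hz₀)
  filter_upwards [Metric.ball_mem_nhds z₀ hε] with z hz
  have hO : IsOpen (Metric.closedBall z₀ ε)ᶜ := Metric.isClosed_closedBall.isOpen_compl
  have hJO : supp J ⊆ (Metric.closedBall z₀ ε)ᶜ := fun w hw hb => hball hb hw
  obtain ⟨χ, h1, h2, h3, h4⟩ := exists_cutoff hJc hO hJO
  have hx := isExtension_formDz h1 h2 hO h3 h4 (differentiableOn_inv_sub (z := z)
    (Set.notMem_compl_iff.2 (Metric.ball_subset_closedBall hz)))
  have hx₀ := isExtension_formDz h1 h2 hO h3 h4 (differentiableOn_inv_sub (z := z₀)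
    (Set.notMem_compl_iff.2 (Metric.mem_closedBall_self hε.le)))
  rw [cauchyIntegral, cauchyIntegral, integral_eq_integralB hx, integral_eq_integralB hx₀]
  have hs := hx.1.add hx₀.1.neg
  -- Off a closed ball about z₀ that contains z and misses the support, the logarithm of the ratio
  -- is a single-valued primitive of the difference of the kernels.
  have h0 := integral_deriv_eq_zero hst ht hJ hJc hO hJO
    (h := fun w => Complex.log (1 + -(z - z₀) * (w - z₀)⁻¹))
    (h' := fun w => (w - z)⁻¹ - (w - z₀)⁻¹) (fun w hw => ?_) hs ?_
  · have e : ∀ η η' : ℂ → ℂ →L[ℝ] ℂ, η = (η + -η') + η' := fun _ _ => by simp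
    rw [integralB_congr (e _ _) hx.1 (hs.add hx₀.1), integralB_add hs hx₀.1, h0, zero_add]
  · refine hasDerivAt_log_ratio ?_
    rw [Set.mem_compl_iff, Metric.mem_closedBall, not_le, dist_eq_norm] at hw
    rw [Metric.mem_ball, dist_eq_norm] at hz
    exact hz.trans hw
  · filter_upwards [hx.2, hx₀.2] with p hp hp₀
    simp only [Pi.add_apply, Pi.neg_apply, hp, hp₀]
    ext
    simp [formDz, sub_eq_add_neg, add_mul]

end Holomorphic

/-! ### The global Cauchy theorem

The closed chain `J` annihilates `f(z) dz` as soon as its index vanishes off `U`: cutting `f` off near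
the compact set where the index is supported, the Cauchy-Pompeiu formula expresses `f` near the
support of `J` as a superposition of Cauchy kernels with poles where the index vanishes. A chain `K`
of finite mass with boundary `J` is not needed. -/

section Cauchy

open MeasureTheory

theorem contDiff_dbar {f : ℂ → ℂ} (hf : ContDiff ℝ ∞ f) : ContDiff ℝ ∞ (dbar f) := by
  have := hf.fderiv_right (m := ∞) (by simp)
  unfold dbar
  fun_prop

theorem hasCompactSupport_dbar {f : ℂ → ℂ} (hc : HasCompactSupport f) :
    HasCompactSupport (dbar f) := by
  refine (hc.fderiv ℝ).mono fun z hz h => hz ?_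
  simp [dbar, h]

theorem dbar_eq_zero {f : ℂ → ℂ} {z : ℂ} (h : DifferentiableAt ℂ f z) : dbar f z = 0 := by
  have e : fderiv ℝ f z = (fderiv ℂ f z).restrictScalars ℝ :=
    (h.hasFDerivAt.restrictScalars ℝ).fderiv
  have h1 : fderiv ℂ f z Complex.I = Complex.I * fderiv ℂ f z 1 := by
    rw [← smul_eq_mul, ← map_smul, smul_eq_mul, mul_one]
  simp only [dbar, e, ContinuousLinearMap.coe_restrictScalars', h1, ← mul_assoc, Complex.I_mul_I]
  ring

/-- The Cauchy kernel cut off in both variables. -/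
def cutKernel (χ : ℂ → ℝ) (g : ℂ → ℂ) (p : ℂ × ℂ) : ℂ :=
  g p.2 * (χ p.1 • (p.1 - p.2)⁻¹)

variable {χ : ℂ → ℝ} {g : ℂ → ℂ}

/-- The kernel is singular only on the diagonal, which the disjoint supports of the two cutoffs
avoid. -/
theorem contDiff_cutKernel (hχ : ContDiff ℝ ∞ χ) (hg : ContDiff ℝ ∞ g)
    (hd : Disjoint (tsupport χ) (tsupport g)) : ContDiff ℝ ∞ (cutKernel χ g) := by
  rw [contDiff_iff_contDiffAt]
  rintro ⟨w, z⟩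
  by_cases hw : w ∈ tsupport χ
  · by_cases hz : z ∈ tsupport g
    · have hne : w - z ≠ 0 := fun h =>
        Set.disjoint_left.1 hd hw (sub_eq_zero.1 h ▸ hz)
      have h1 : ContDiffAt ℝ ∞ (fun p : ℂ × ℂ => (p.1 - p.2)⁻¹) (w, z) :=
        (contDiff_fst.sub contDiff_snd).contDiffAt.inv hne
      exact (hg.comp contDiff_snd).contDiffAt.mul
        (((hχ.comp contDiff_fst).contDiffAt).smul h1)
    · have : cutKernel χ g =ᶠ[𝓝 (w, z)] fun _ => 0 := by
        filter_upwards [continuous_snd.continuousAt.eventually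
          (notMem_tsupport_iff_eventuallyEq.1 hz)] with q hq
        simp [cutKernel, hq]
      exact contDiffAt_const.congr_of_eventuallyEq this
  · have : cutKernel χ g =ᶠ[𝓝 (w, z)] fun _ => 0 := by
      filter_upwards [continuous_fst.continuousAt.eventually
        (notMem_tsupport_iff_eventuallyEq.1 hw)] with q hq
      simp [cutKernel, hq]
    exact contDiffAt_const.congr_of_eventuallyEq this

theorem hasCompactSupport_cutKernel (hχ : HasCompactSupport χ) (hg : HasCompactSupport g) :
    HasCompactSupport (cutKernel χ g) := by
  refine HasCompactSupport.of_support_subset_isCompact (hχ.isCompact.prod hg.isCompact) ?_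
  rintro ⟨w, z⟩ h
  refine ⟨?_, ?_⟩ <;> refine subset_tsupport _ fun h0 => h ?_ <;> simp_all [cutKernel]

/-- Uniform bounds for the forms `H(w, z) dw` with parameter `z`. -/
theorem exists_diffBound_slice {H : ℂ × ℂ → ℂ} (hH : ContDiff ℝ ∞ H) (hc : HasCompactSupport H)
    (n : ℕ) : ∃ C : ℝ, 0 ≤ C ∧ ∀ z, DiffBound n C (formDz fun w => H (w, z)) := by
  obtain ⟨C, hC, h⟩ := exists_diffBound hH hc n
  let T : ℂ →L[ℝ] ℂ →L[ℝ] ℂ :=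
    (ContinuousLinearMap.toSpanSingleton ℂ (ContinuousLinearMap.id ℝ ℂ)).restrictScalars ℝ
  refine ⟨‖T‖ * C, by positivity, fun z => ?_⟩
  -- The slice at height z is a translate of an isometric inclusion, so one constant serves all z.
  have h1 := h.comp_affine hC (AddMonoidHom.inl ℂ ℂ) (fun u => by simp) (0, z)
  simp only [AddMonoidHom.inl_apply, Prod.mk_add_mk, add_zero, zero_add] at h1
  exact h1.comp_clm T

/-- Evaluation on pointed chains commutes with integration in a parameter. -/
theorem evalForm_integral {H : ℂ × ℂ → ℂ} (hH : Continuous H) (hc : HasCompactSupport H)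
    (A : ℂ →₀ ℂ) :
    MeasureTheory.Integrable (fun z => evalForm (formDz fun w => H (w, z)) A) ∧
      evalForm (formDz fun w => ∫ z, H (w, z)) A =
        ∫ z, evalForm (formDz fun w => H (w, z)) A := by
  induction A using Finsupp.induction_linear with
  | zero => simp
  | add f g hf hg =>
    simp only [map_add]
    exact ⟨hf.1.add hg.1, by rw [hf.2, hg.2, integral_add hf.1 hg.1]⟩
  | single p α =>
    have hi : MeasureTheory.Integrable fun z => H (p, z) := by
      refine (hH.comp (by fun_prop : Continuous fun z : ℂ => (p, z))).integrable_of_hasCompactSupport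
        ?_
      refine HasCompactSupport.of_support_subset_isCompact (hc.isCompact.image continuous_snd) ?_
      exact fun z hz => ⟨(p, z), subset_tsupport _ hz, rfl⟩
    simp only [evalForm_single, formDz, smul_apply,
      ContinuousLinearMap.id_apply, smul_eq_mul]
    exact ⟨hi.mul_const _, (integral_mul_const _ _).symm⟩

/-- If `J` annihilates the forms `H(w, z) dw` for all `z`, then it annihilates their integral. -/
theorem integralB_integral_eq_zero {n : ℕ} {J : Chain ℂ ℂ n} {H : ℂ × ℂ → ℂ}
    (hH : ContDiff ℝ ∞ H) (hc : HasCompactSupport H)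
    (h0 : ∀ z, ∀ hB : IsBForm n (formDz fun w => H (w, z)),
      integralB (formDz fun w => H (w, z)) hB J = 0)
    (hB : IsBForm n (formDz fun w => ∫ z, H (w, z))) :
    integralB (formDz fun w => ∫ z, H (w, z)) hB J = 0 := by
  obtain ⟨C, hC, hb⟩ := exists_diffBound_slice hH hc n
  obtain ⟨A, hA⟩ := exists_tendsto_ofPointed J
  let S : Set ℂ := Prod.snd '' tsupport H
  have hS : IsCompact S := hc.isCompact.image continuous_snd
  refine integralB_eq_of_tendsto hB hA ?_
  -- Since `J` annihilates each slice, evaluating it on the pointed chain equals integrating it over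
  -- the difference from `J`. The common constant and the compact parameter set bound the whole
  -- integral, with no Fubini theorem for general chains.
  have hbound : ∀ i, ‖evalForm (formDz fun w => ∫ z, H (w, z)) (A i)‖ ≤
      C * ‖ofPointed n (A i) - J‖ * volume.real S := by
    intro i
    rw [(evalForm_integral hH.continuous hc (A i)).2,
      ← setIntegral_eq_integral_of_forall_compl_eq_zero (s := S)]
    · refine norm_setIntegral_le_of_norm_le_const hS.measure_lt_top fun z _ => ?_
      have hz : IsBForm n (formDz fun w => H (w, z)) := (hb z).isBForm hC
      have := norm_integralB_le hC (hb z) hz (ofPointed n (A i) - J)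
      rwa [map_sub, h0 z hz, sub_zero, integralB_ofPointed] at this
    · intro z hz
      have : (formDz fun w => H (w, z)) = 0 := by
        funext w
        have : H (w, z) = 0 := image_eq_zero_of_notMem_tsupport fun h => hz ⟨_, h, rfl⟩
        ext
        simp [formDz, this]
      simp [this, evalForm, Finsupp.sum]
  refine squeeze_zero_norm hbound ?_
  have := ((hA.sub_const J).norm.const_mul C).mul_const (volume.real S)
  simpa using this

/-- The homology version of the global Cauchy theorem, for closed differential chains. -/
theorem integral_formDz_eq_zero {s t : ℕ} (hst : s < t) (ht : 2 ≤ t) {J : Chain ℂ ℂ s}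
    (hJ : boundary₁ hst ht J = 0) {U : Set ℂ} (hU : IsOpen U) (hUb : Bornology.IsBounded U)
    (hJU : supp J ⊆ U) (hInd : ∀ z, z ∉ U → cauchyIntegral J z = 0) {f : ℂ → ℂ}
    (hf : DifferentiableOn ℂ f U) :
    Integrable J (formDz f) ∧ integral J (formDz f) = 0 := by
  have hJc : IsCompact (supp J) :=
    Metric.isCompact_of_isClosed_isBounded (isClosed_supp J) (hUb.subset hJU)
  -- The implication puts every point of supp J into N, whatever value `cauchyIntegral` takes there.
  let N : Set ℂ := {z | z ∉ supp J → cauchyIntegral J z ≠ 0}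
  have hNU : N ⊆ U := fun z hz => by_contra fun h => hz (fun h' => h (hJU h')) (hInd z h)
  have hJN : supp J ⊆ N := fun z hz h => absurd hz h
  have hNo : IsOpen Nᶜ := by
    rw [isOpen_iff_mem_nhds]
    intro z hz
    have hz' : z ∉ supp J ∧ cauchyIntegral J z = 0 := by simpa [N] using hz
    filter_upwards [(isClosed_supp J).isOpen_compl.mem_nhds hz'.1,
      eventually_cauchyIntegral_eq hst ht hJ hJc hz'.1] with y hy hy'
    exact fun h => h hy (hy'.trans hz'.2)
  have hNc : IsCompact N :=
    Metric.isCompact_of_isClosed_isBounded (isOpen_compl_iff.1 hNo) (hUb.subset hNU)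
  obtain ⟨χ, h1, h2, h3, h4⟩ := exists_cutoff hNc hU hNU
  have hx : IsExtension J (formDz f) (formDz (χ • f)) :=
    isExtension_formDz h1 h2 hU h3 (h4.filter_mono (nhdsSet_mono hJN)) hf
  refine ⟨⟨_, hx⟩, ?_⟩
  rw [integral_eq_integralB hx]
  let F : ℂ → ℂ := χ • f
  have hF : ContDiff ℝ ∞ F := contDiff_cutoff_smul h1 hU h3 hf
  have hFc : HasCompactSupport F := h2.smul_right
  have hg : ContDiff ℝ ∞ (dbar F) := contDiff_dbar hF
  have hgc : HasCompactSupport (dbar F) := hasCompactSupport_dbar hFc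
  -- Near N the function F is the holomorphic f, so its Wirtinger derivative vanishes.
  have hgN : ∀ z ∈ N, z ∉ tsupport (dbar F) := by
    obtain ⟨O, hO, hNO, hχ⟩ := eventually_nhdsSet_iff_exists.1 h4
    intro z hz
    rw [notMem_tsupport_iff_eventuallyEq]
    filter_upwards [(hO.inter hU).mem_nhds ⟨hNO hz, hNU hz⟩] with y hy
    refine dbar_eq_zero ((hf.differentiableAt (hU.mem_nhds hy.2)).congr_of_eventuallyEq ?_)
    filter_upwards [hO.mem_nhds hy.1] with x hx
    simp [F, hχ x hx]
  -- The second cutoff is 1 near supp J and keeps w away from the poles z, which range over the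
  -- support of ∂̄F.
  obtain ⟨ψ, k1, k2, k3, k4⟩ := exists_cutoff hJc (isClosed_tsupport (dbar F)).isOpen_compl
    (fun z hz => hgN z (hJN hz))
  have hd : Disjoint (tsupport ψ) (tsupport (dbar F)) :=
    Set.disjoint_left.2 fun z hz => k3 hz
  let g : ℂ → ℂ := fun z => (Real.pi : ℂ)⁻¹ * dbar F z
  have hg' : ContDiff ℝ ∞ g := contDiff_const.mul hg
  have hgs : tsupport g ⊆ tsupport (dbar F) := tsupport_mul_subset_right
  have hgc' : HasCompactSupport g := hgc.mul_left
  have hd' : Disjoint (tsupport ψ) (tsupport g) := hd.mono_right hgs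
  have hH := contDiff_cutKernel k1 hg' hd'
  have hHc := hasCompactSupport_cutKernel k2 hgc'
  -- This is Cauchy-Pompeiu for F; its minus sign is absorbed by writing w - z in the kernel, and π
  -- by the factor in g.
  have hrep : (fun w => ∫ z, cutKernel ψ g (w, z)) = ψ • F := by
    funext w
    have e : ∀ z, cutKernel ψ g (w, z) =
        -(ψ w * (Real.pi : ℂ)⁻¹) * (dbar F z / (z - w)) := by
      intro z
      rw [cutKernel, Complex.real_smul, ← neg_sub z w, inv_neg]
      simp only [g]
      ring
    have hpi : (Real.pi : ℂ) ≠ 0 := by exact_mod_cast Real.pi_ne_zero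
    simp only [e]
    rw [integral_const_mul, integral_dbar_div hF hFc, Pi.smul_apply', Complex.real_smul]
    field_simp
  have hψF : IsBForm s (formDz (ψ • F)) := isBForm_formDz
    (k1.smul hF) k2.smul_right s
  rw [integralB_eq_of_eventuallyEq J hx.1 hψF
    (k4.mono fun p hp => by simp [formDz, hp, F])]
  have hB : IsBForm s (formDz fun w => ∫ z, cutKernel ψ g (w, z)) := by rwa [hrep]
  rw [integralB_congr (by rw [hrep]) hψF hB]
  refine integralB_integral_eq_zero hH hHc (fun z hz => ?_) hB
  -- A pole in the support of g lies off N, where the Cauchy integral of `J` is zero; for any other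
  -- z the slice vanishes identically.
  by_cases hzs : z ∈ tsupport g
  · have hzN : z ∉ N := fun h => hgN z h (hgs hzs)
    have hz0 : cauchyIntegral J z = 0 := by
      simp only [N, Set.mem_ofPred_eq, not_forall, not_not] at hzN
      exact hzN.2
    have hxz := isExtension_formDz k1 k2 isOpen_compl_singleton
      (fun w hw (h : w = z) => Set.disjoint_left.1 hd' hw (h ▸ hzs)) k4
      (differentiableOn_inv_sub (z := z) (by simp))
    have := integralB_formDz_const_mul (g z) hxz.1 hz J
    refine this.trans ?_
    rw [← integral_eq_integralB hxz]
    exact mul_eq_zero_of_right _ hz0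
  · have hgz : g z = 0 := image_eq_zero_of_notMem_tsupport hzs
    refine integralB_eq_zero J hz (Eventually.of_forall fun w => ?_)
    simp [formDz, cutKernel, hgz]

end Cauchy

end DiffChain

end

/-- Writing the order of `J` as `r + 1` encodes that it is at least 1. The identity ∂K = J is read
in order `r + 2`, which is admissible for every r, including r = 0, where the boundary of `K`
already requires order 2. -/
theorem mainTheorem7 (r : ℕ) (J : DiffChain.Chain ℂ ℂ (r + 1))
    (hJ : DiffChain.boundary₁ (t := r + 2) (by omega) (by omega) J = 0)
    (U : Set ℂ) (hU : IsOpen U) (hUb : Bornology.IsBounded U) (hJU : DiffChain.supp J ⊆ U)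
    (hInd : ∀ w, w ∉ U → DiffChain.windingNumber J w = 0)
    (K : DiffChain.Chain ℂ ℝ r) (hK : DiffChain.mass K < ⊤)
    (hKJ : DiffChain.boundary₂ (t := r + 2) (by omega) (by omega) K =
      DiffChain.incl (Nat.le_succ (r + 1)) J)
    (f : ℂ → ℂ) (hf : DifferentiableOn ℂ f U) :
    DiffChain.Integrable J (DiffChain.formDz f) ∧
      DiffChain.integral J (DiffChain.formDz f) = 0 := by
  refine DiffChain.integral_formDz_eq_zero _ _ hJ hU hUb hJU (fun z hz => ?_) hf
  have hne : (2 * Real.pi * Complex.I : ℂ)⁻¹ ≠ 0 :=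
    inv_ne_zero Complex.two_pi_I_ne_zero
  exact (mul_eq_zero.1 (hInd z hz)).resolve_left hne
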